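/- **Setup.** For a finite set $L$, a graph on $L$ is a finite directed graph with vertex set $L$, loops and multiple edges allowed; it is regular of degree $k$ if every vertex has valence $k$ (loops counted twice). The regular graphs on $L$ form a commutative semigroup $\mathcal G_L^{\mathrm{reg}}$ under disjoint union of edge sets; write $X_\Gamma$ for the element of the semigroup algebra $\mathbb Z[\mathcal G_L^{\mathrm{reg}}]$ given by $\Gamma$. Let $R_L$ be the quotient of $\mathbb Z[\mathcal G_L^{\mathrm{reg}}]$ by the relations - (loop) $X_\Gamma=0$ if $\Gamma$ has a loop; - (sign) $X_\Gamma=-X_{\Gamma'}$ if $\Gamma'$ is obtained from $\Gamma$ by reversing one edge; - (Plücker) $X_\Gamma=X_{\Gamma'}+X_{\Gamma''}$ if $\Gamma'$ and $\Gamma''$ are obtained from $\Gamma$ by replacing two edges $(\overrightarrow{ab},\overrightarrow{cd})$ by $(\overrightarrow{ad},\overrightarrow{cb})$ and by $(\overrightarrow{ac},\overrightarrow{bd})$ respectively. (This is the projective coordinate ring of the space of $L$ points on $\mathbb P^1$ modulo $\mathrm{SL}(2)$.) Let $V_L=R_L^{(1)}\subset R_L$ be the $\mathbb Z$-span of the $X_\Gamma$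 with $\Gamma$ a matching, that is, regular of degree one; let $I_L$ be the kernel of the natural ring homomorphism $\mathrm{Sym}(V_L)\to R_L$, and let $I_L^{(2)}=I_L\cap \mathrm{Sym}^2(V_L)$. A *simple binomial relation* on $L$ is an element of $I_L^{(2)}$ of the form $$X_{\Gamma\Delta}X_{\Gamma'\Delta'}-X_{\Gamma\Delta'}X_{\Gamma'\Delta},$$ where $U\subset L$ is a subset with four elements, $\Delta,\Delta'$ are matchings on $U$, $\Gamma,\Gamma'$ are matchings on $L\setminus U$, and $\Gamma\Delta$, etc., denotes the union, a matching on $L$. We say that $I_L^{(2)}$ is *spanned over a commutative ring $A$ by simple binomial relations* if the $A$-module $A\otimes_{\mathbb Z}I_L^{(2)}$ is spanned by the elements $1\otimes r$ with $r$ a simple binomial relation. **Theorem 1.3.** Let $N$ be a positive integer and let $L$ be a finite set of even cardinality with $|L|\ge 10$ and $|L|\ne 12$. Suppose that for every finite set $L'$ of even cardinality with $|L'|<|L|$, $I_{L'}^{(2)}$ is spanned over $\mathbb Z[\tfrac1{2N}]$ by simple binomial relations. Then $I_L^{(2)}$ is spanned over $\mathbb Z[\tfrac1{2N}]$ by simple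 binomial relations. -/

import Mathlib

open scoped TensorProduct

universe u

noncomputable section

namespace PointsOnLine

/-- A finite directed graph on the vertex set `L`, loops and multiple edges allowed, is the
multiset of its edges; the pair `(a, b)` is the edge from `a` to `b`. The semigroup law
(disjoint union of the edges) is the addition of multisets. -/
abbrev Graph (L : Type u) : Type u := Multiset (L × L)

open scoped Classical in
/-- The valence of the vertex `v`: the number of edge ends at `v` (a loop counts twice). -/
def valence {L : Type u} (Γ : Graph L) (v : L) : ℕ :=
  (Γ.map Prod.fst).count v + (Γ.map Prod.snd).count v

theorem valence_add {L : Type u} (Γ Δ : Graph L) (v : L) :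
    valence (Γ + Δ) v = valence Γ v + valence Δ v := by
  simp only [valence, Multiset.map_add, Multiset.count_add]
  omega

theorem valence_zero {L : Type u} (v : L) : valence (0 : Graph L) v = 0 := by
  simp [valence]

/-- Every vertex has valence `k`. -/
def IsRegular {L : Type u} (k : ℕ) (Γ : Graph L) : Prop := ∀ v : L, valence Γ v = k

/-- The semigroup of regular directed graphs on `L`. -/
def regularGraphs (L : Type u) : AddSubmonoid (Graph L) where
  carrier := {Γ | ∃ k, IsRegular k Γ}
  zero_mem' := ⟨0, fun v => valence_zero v⟩
  add_mem' := by
    rintro Γ Δ ⟨k, hk⟩ ⟨m, hm⟩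
    exact ⟨k + m, fun v => by rw [valence_add, hk v, hm v]⟩

/-- The semigroup algebra, over `ℤ`, of the semigroup of regular directed graphs on `L`. -/
abbrev GraphAlgebra (L : Type u) : Type u := AddMonoidAlgebra ℤ (regularGraphs L)

/-- The element of the semigroup algebra given by a regular graph. -/
def graphElt {L : Type u} (Γ : regularGraphs L) : GraphAlgebra L := AddMonoidAlgebra.single Γ 1

/-- The loop, sign and Plücker relations; each element of this type of relation is required
to vanish in the ring `R_L`. -/
inductive IsGraphRelation {L : Type u} : GraphAlgebra L → Prop
  | loop (Γ : regularGraphs L) (a : L) (h : (a, a) ∈ (Γ : Graph L)) :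
      IsGraphRelation (graphElt Γ)
  | sign (Γ Γ' : regularGraphs L) (E : Graph L) (a b : L)
      (h : (Γ : Graph L) = E + {(a, b)}) (h' : (Γ' : Graph L) = E + {(b, a)}) :
      IsGraphRelation (graphElt Γ + graphElt Γ')
  | pluecker (Γ Γ' Γ'' : regularGraphs L) (E : Graph L) (a b c d : L)
      (h : (Γ : Graph L) = E + {(a, b), (c, d)})
      (h' : (Γ' : Graph L) = E + {(a, d), (c, b)})
      (h'' : (Γ'' : Graph L) = E + {(a, c), (b, d)}) :
      IsGraphRelation (graphElt Γ - (graphElt Γ' + graphElt Γ''))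

/-- The ring `R_L`. -/
abbrev InvariantRing (L : Type u) : Type u :=
  GraphAlgebra L ⧸ Ideal.span {r : GraphAlgebra L | IsGraphRelation r}

/-- The element `X_Γ` of `R_L`. -/
def X {L : Type u} (Γ : regularGraphs L) : InvariantRing L := Ideal.Quotient.mk _ (graphElt Γ)

theorem X_add {L : Type u} (Γ Δ : regularGraphs L) : X (Γ + Δ) = X Γ * X Δ := by
  simp only [X, graphElt]
  rw [← map_mul, AddMonoidAlgebra.single_mul_single, one_mul]

/-- The graded piece `R_L^{(k)}`: the span of the `X_Γ` with `Γ` regular of degree `k`. -/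
def gradedPiece (L : Type u) (k : ℕ) : Submodule ℤ (InvariantRing L) :=
  Submodule.span ℤ {x | ∃ Γ : regularGraphs L, IsRegular k (Γ : Graph L) ∧ x = X Γ}

/-- `V_L = R_L^{(1)}`. -/
abbrev V (L : Type u) : Submodule ℤ (InvariantRing L) := gradedPiece L 1

/-- The canonical ring homomorphism `Sym(V_L) → R_L`. -/
def symToRing (L : Type u) : SymmetricAlgebra ℤ (V L) →ₐ[ℤ] InvariantRing L :=
  SymmetricAlgebra.lift (V L).subtype

/-- The ideal of relations `I_L`, the kernel of `Sym(V_L) → R_L`. -/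
def relationIdeal (L : Type u) : Ideal (SymmetricAlgebra ℤ (V L)) :=
  RingHom.ker (symToRing L)

/-- The graded piece `Sym^k(V_L)`: the span of the products of `k` elements of `V_L`. -/
def symPiece (L : Type u) (k : ℕ) : Submodule ℤ (SymmetricAlgebra ℤ (V L)) :=
  LinearMap.range (SymmetricAlgebra.ι ℤ (V L)) ^ k

/-- The quadratic relations `I_L^{(2)}`, that is, the elements of `I_L` of degree two. -/
def quadraticRelations (L : Type u) : Submodule ℤ (SymmetricAlgebra ℤ (V L)) :=
  (relationIdeal L).restrictScalars ℤ ⊓ symPiece L 2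

/-- `Γ` is a (directed) matching with vertex set `U`, viewed as a graph on `L ⊇ U`: each vertex
in `U` lies on exactly one edge (not a loop), and no edge meets the complement of `U`. -/
def IsMatchingOn {L : Type u} (U : Set L) (Γ : Graph L) : Prop :=
  (∀ v ∈ U, valence Γ v = 1) ∧ ∀ v ∉ U, valence Γ v = 0

/-- The union of a matching on the complement of `U` and a matching on `U` is a matching
on `L`. -/
theorem IsMatchingOn.union {L : Type u} {U : Set L} {Γ Δ : Graph L}
    (hΓ : IsMatchingOn Uᶜ Γ) (hΔ : IsMatchingOn U Δ) : IsRegular 1 (Γ + Δ) := by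
  intro v
  rw [valence_add]
  by_cases hv : v ∈ U
  · rw [hΓ.2 v (by simpa using hv), hΔ.1 v hv]
  · rw [hΓ.1 v hv, hΔ.2 v hv]

/-- The element `X_Γ` of `V_L`, for a matching `Γ` on `L`. -/
def matchingElt {L : Type u} (Γ : Graph L) (h : IsRegular 1 Γ) : V L :=
  ⟨X ⟨Γ, 1, h⟩, Submodule.subset_span ⟨⟨Γ, 1, h⟩, h, rfl⟩⟩

/-- The class of `X_Γ` in `Sym(V_L)`, for a matching `Γ` on `L`. -/
def symElt {L : Type u} (Γ : Graph L) (h : IsRegular 1 Γ) : SymmetricAlgebra ℤ (V L) :=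
  SymmetricAlgebra.ι ℤ (V L) (matchingElt Γ h)

/-- The simple binomial relations: for a four-element subset `U` of `L`, matchings `Δ`, `Δ'`
on `U` and matchings `Γ`, `Γ'` on the complement of `U`, the element
`X_{ΓΔ} X_{Γ'Δ'} - X_{ΓΔ'} X_{Γ'Δ}` of `Sym(V_L)`. -/
inductive IsSimpleBinomial {L : Type u} : SymmetricAlgebra ℤ (V L) → Prop
  | mk (U : Set L) (hU : U.ncard = 4) (Δ Δ' Γ Γ' : Graph L)
      (hΔ : IsMatchingOn U Δ) (hΔ' : IsMatchingOn U Δ')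
      (hΓ : IsMatchingOn Uᶜ Γ) (hΓ' : IsMatchingOn Uᶜ Γ') :
      IsSimpleBinomial
        (symElt (Γ + Δ) (hΓ.union hΔ) * symElt (Γ' + Δ') (hΓ'.union hΔ')
          - symElt (Γ + Δ') (hΓ.union hΔ') * symElt (Γ' + Δ) (hΓ'.union hΔ))

/-- Simple binomial relations are quadratic relations. -/
theorem IsSimpleBinomial.mem {L : Type u} {r : SymmetricAlgebra ℤ (V L)}
    (hr : IsSimpleBinomial r) : r ∈ quadraticRelations L := by
  obtain ⟨U, hU, Δ, Δ', Γ, Γ', hΔ, hΔ', hΓ, hΓ'⟩ := hr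
  refine ⟨?_, ?_⟩
  · change symToRing L _ = 0
    simp only [map_sub, map_mul, symElt, symToRing, SymmetricAlgebra.lift_ι_apply,
      matchingElt, Submodule.subtype_apply, ← X_add]
    rw [sub_eq_zero]
    refine congrArg X (Subtype.ext ?_)
    change (Γ + Δ) + (Γ' + Δ') = (Γ + Δ') + (Γ' + Δ)
    abel
  · have hm : ∀ (G H : Graph L) (hG : IsRegular 1 G) (hH : IsRegular 1 H),
        symElt G hG * symElt H hH ∈ symPiece L 2 := by
      intro G H hG hH
      rw [symPiece, pow_two]
      exact Submodule.mul_mem_mul ⟨_, rfl⟩ ⟨_, rfl⟩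
    exact Submodule.sub_mem _ (hm _ _ _ _) (hm _ _ _ _)

/-- The set of simple binomial relations, in `I_L^{(2)}`. -/
def simpleBinomials (L : Type u) : Set (quadraticRelations L) :=
  {r | IsSimpleBinomial (r : SymmetricAlgebra ℤ (V L))}

/-- `I_L^{(2)}` is spanned over `A` by the simple binomial relations: their images span the
`A`-module `A ⊗ I_L^{(2)}`. -/
def SpannedBySimpleBinomials (A : Type) [CommRing A] (L : Type u) : Prop :=
  Submodule.span A ((fun r : quadraticRelations L => (1 : A) ⊗ₜ[ℤ] r) '' simpleBinomials L) = ⊤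

end PointsOnLine

end

noncomputable section

namespace PointsOnLine

/-! Once two is invertible, everything reduces to squares of matchings.

Polarization. Up to powers of two, the squares `X_Γ ^ 2` span `Sym²(V_L)` (`symPiece_two_le`). A sum
of two matchings is not a matching, so this is not the usual polarization. It rests on
`IsNullForm.eq_zero`: a symmetric form on matchings that obeys the sign and Plücker relations and
vanishes on the diagonal is zero if its values have no two-torsion. Plücker moves reduce the claim
to pairs of matchings forming a Hamiltonian cycle. There the form is alternating in the cyclic word
of vertices, but also invariant under rotation, which for an even number of letters is an odd
permutation.

Straightening. The square of the bracket of two points of the projective line is the inner product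
of two points of a conic in three-space, so `X_Γ ^ 2` behaves like a product of entries of a Gram
matrix of rank three. The four-by-four minors of such a matrix vanish, and in `Sym²(V_L)` the minor
with disjoint rows and columns, times a fixed set of edges, is exactly twice a simple binomial
relation (`IsPluecker.sum_sq`). Modulo binomials the minors reduce every square to squares of
standard matchings, those without four pairwise non-nested edges (`sq_mem_sup_standardMatchings`).

Independence. The squares of the standard matchings are linearly independent in `R_L`
(`standardMatchings_independent`). Evaluations on the conic extend to arbitrary vectors by
multilinearity. Assigning one of three orthogonal vectors to each vertex, according to a colouring
in which edges of one colour are nested, gives a triangular system by the rearrangement inequality.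

A quadratic relation is thus, up to a power of two, a combination of binomials plus one of standard
squares, and the latter has zero coefficients because its image in `R_L` is zero. -/

/-- A function on graphs satisfying the sign relation and the Plücker relation. -/
structure IsPluecker {L : Type u} {M : Type*} [AddCommGroup M] (m : Graph L → M) : Prop where
  sign : ∀ (E : Graph L) (a b : L), m ((a, b) ::ₘ E) = -m ((b, a) ::ₘ E)
  pluecker : ∀ (E : Graph L) (a b c d : L), m ((a, b) ::ₘ (c, d) ::ₘ E) =
    m ((a, d) ::ₘ (c, b) ::ₘ E) + m ((a, c) ::ₘ (b, d) ::ₘ E)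

/-! ### Alternating sums of Plücker functions -/

section Determinant

variable {L : Type u} {M : Type*} [AddCommGroup M] {m : Graph L → M}

/-- The alternating sum over the bijections between two sets of three vertices vanishes. -/
theorem IsPluecker.six_term (hm : IsPluecker m) (E : Graph L) (a b c x y z : L) :
    m ((a, x) ::ₘ (b, y) ::ₘ (c, z) ::ₘ E) - m ((a, x) ::ₘ (b, z) ::ₘ (c, y) ::ₘ E)
      - m ((a, y) ::ₘ (b, x) ::ₘ (c, z) ::ₘ E) + m ((a, y) ::ₘ (b, z) ::ₘ (c, x) ::ₘ E)
      + m ((a, z) ::ₘ (b, x) ::ₘ (c, y) ::ₘ E) - m ((a, z) ::ₘ (b, y) ::ₘ (c, x) ::ₘ E) = 0 := by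
  -- The Plücker relation pairs the six terms into three that all contain the edge `(b, c)`; these
  -- are the three terms of one more Plücker relation, on `a, x, y, z`.
  have key : ∀ p q r : L, m ((a, p) ::ₘ (b, q) ::ₘ (c, r) ::ₘ E)
      - m ((a, p) ::ₘ (b, r) ::ₘ (c, q) ::ₘ E) = m ((a, p) ::ₘ (q, r) ::ₘ (b, c) ::ₘ E) := by
    intro p q r
    have h := hm.pluecker ((a, p) ::ₘ E) b q c r
    simp only [Multiset.cons_swap _ (a, p)] at h
    rw [h, Multiset.cons_swap (b, c) (q, r)]
    abel
  have hx := key x y z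
  have hy := key y x z
  have hz := key z x y
  have h := hm.pluecker ((b, c) ::ₘ E) a x y z
  have h1 := hm.sign ((x, z) ::ₘ (b, c) ::ₘ E) a y
  have h2 := hm.sign ((a, z) ::ₘ (b, c) ::ₘ E) y x
  rw [Multiset.cons_swap (y, x) (a, z), Multiset.cons_swap (x, y) (a, z)] at h2
  rw [h2] at h
  linear_combination (norm := abel) hx - hy + hz + h

end Determinant

/-- If `g` satisfies the six-term relations, then the alternating sum of the squares of its values
at the permutations of `0, 1, 2, 3` is twice a two-by-two determinant. -/
theorem sum_sign_sq_eq {R : Type*} [CommRing R] (g : Fin 4 → Fin 4 → Fin 4 → Fin 4 → R)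
    (h00 : g 0 1 2 3 - g 0 1 3 2 - g 0 2 1 3 + g 0 2 3 1 + g 0 3 1 2 - g 0 3 2 1 = 0)
    (h01 : g 1 0 2 3 - g 1 0 3 2 - g 1 2 0 3 + g 1 2 3 0 + g 1 3 0 2 - g 1 3 2 0 = 0)
    (h02 : g 2 0 1 3 - g 2 0 3 1 - g 2 1 0 3 + g 2 1 3 0 + g 2 3 0 1 - g 2 3 1 0 = 0)
    (h03 : g 3 0 1 2 - g 3 0 2 1 - g 3 1 0 2 + g 3 1 2 0 + g 3 2 0 1 - g 3 2 1 0 = 0)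
    (h10 : g 1 0 2 3 - g 1 0 3 2 - g 2 0 1 3 + g 2 0 3 1 + g 3 0 1 2 - g 3 0 2 1 = 0)
    (h11 : g 0 1 2 3 - g 0 1 3 2 - g 2 1 0 3 + g 2 1 3 0 + g 3 1 0 2 - g 3 1 2 0 = 0)
    (h12 : g 0 2 1 3 - g 0 2 3 1 - g 1 2 0 3 + g 1 2 3 0 + g 3 2 0 1 - g 3 2 1 0 = 0)
    (h20 : g 1 2 0 3 - g 1 3 0 2 - g 2 1 0 3 + g 2 3 0 1 + g 3 1 0 2 - g 3 2 0 1 = 0)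
    (h21 : g 0 2 1 3 - g 0 3 1 2 - g 2 0 1 3 + g 2 3 1 0 + g 3 0 1 2 - g 3 2 1 0 = 0)
    (h22 : g 0 1 2 3 - g 0 3 2 1 - g 1 0 2 3 + g 1 3 2 0 + g 3 0 2 1 - g 3 1 2 0 = 0) :
    g 0 1 2 3 ^ 2 - g 0 1 3 2 ^ 2 - g 0 2 1 3 ^ 2 + g 0 2 3 1 ^ 2 + g 0 3 1 2 ^ 2 - g 0 3 2 1
      ^ 2 - g 1 0 2 3 ^ 2 + g 1 0 3 2 ^ 2 + g 1 2 0 3 ^ 2 - g 1 2 3 0 ^ 2 - g 1 3 0 2 ^ 2 + g 1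
      3 2 0 ^ 2 + g 2 0 1 3 ^ 2 - g 2 0 3 1 ^ 2 - g 2 1 0 3 ^ 2 + g 2 1 3 0 ^ 2 + g 2 3 0 1 ^ 2
      - g 2 3 1 0 ^ 2 - g 3 0 1 2 ^ 2 + g 3 0 2 1 ^ 2 + g 3 1 0 2 ^ 2 - g 3 1 2 0 ^ 2 - g 3 2 0
      1 ^ 2 + g 3 2 1 0 ^ 2 =
      2 * ((g 0 1 2 3 - g 0 1 3 2 - g 1 0 2 3 + g 1 0 3 2) *
        (g 0 1 2 3 - g 0 3 2 1 - g 2 1 0 3 + g 2 3 0 1) -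
      (g 0 2 1 3 - g 0 2 3 1 - g 2 0 1 3 + g 2 0 3 1) *
        (g 0 2 1 3 - g 0 3 1 2 - g 1 2 0 3 + g 1 3 0 2)) := by
  -- The ten relations eliminate ten of the twenty-four values; in the remaining fourteen (a Catalan
  -- number) the claim is a polynomial identity.
  have e0 : g 3 2 1 0 =
      - g 0 1 2 3 + g 0 1 3 2 + 2 * g 0 2 1 3 - g 0 2 3 1 - g 0 3 1 2 + g 1 0 2 3 - g 1 0 3 2 -
      g 1 2 0 3 + g 1 2 3 0 - g 2 0 1 3 + g 2 3 0 1 + g 3 0 1 2 := by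
    linear_combination - h02 + h03 - h10 + h11 - h12 - h21
  have e1 : g 3 2 0 1 =
      - g 0 1 2 3 + g 0 1 3 2 + g 0 2 1 3 - g 0 3 1 2 + g 1 0 2 3 - g 1 0 3 2 - g 2 0 1 3 + g 2
      3 0 1 + g 3 0 1 2 := by
    linear_combination - h02 + h03 - h10 + h11 - h21
  have e2 : g 3 1 2 0 =
      g 0 1 3 2 + g 0 2 1 3 - g 0 2 3 1 - g 0 3 1 2 + g 1 0 2 3 - 2 * g 1 0 3 2 - g 1 2 0 3 + g
      1 2 3 0 + g 1 3 0 2 - g 2 0 1 3 + g 2 0 3 1 + g 3 0 1 2 := by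
    linear_combination h00 - h01 - h10 - h22
  have e3 : g 3 1 0 2 =
      g 0 1 3 2 - g 0 3 1 2 - g 1 0 3 2 + g 1 3 0 2 + g 3 0 1 2 := by
    linear_combination h00 - h01 - h03 + h12 - h22
  have e4 : g 3 0 2 1 =
      g 1 0 2 3 - g 1 0 3 2 - g 2 0 1 3 + g 2 0 3 1 + g 3 0 1 2 := by
    linear_combination - h10
  have e5 : g 2 3 1 0 =
      - g 0 1 2 3 + g 0 1 3 2 + g 0 2 1 3 - g 0 2 3 1 + g 1 0 2 3 - g 1 0 3 2 - g 1 2 0 3 + g 1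
      2 3 0 + g 2 3 0 1 := by
    linear_combination - h02 + h03 - h10 + h11 - h12
  have e6 : g 2 1 3 0 =
      g 0 1 3 2 - g 0 2 3 1 - g 1 0 3 2 + g 1 2 3 0 + g 2 0 3 1 := by
    linear_combination h00 - h01 + h02 - h03 - h20 + h21 - h22
  have e7 : g 2 1 0 3 =
      g 0 1 2 3 - g 0 2 1 3 - g 1 0 2 3 + g 1 2 0 3 + g 2 0 1 3 := by
    linear_combination h00 - h01 + h02 - 2 * h03 + h10 - h11 + h12 - h20 + h21 - h22
  have e8 : g 1 3 2 0 =
      g 1 0 2 3 - g 1 0 3 2 - g 1 2 0 3 + g 1 2 3 0 + g 1 3 0 2 := by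
    linear_combination - h01
  have e9 : g 0 3 2 1 =
      g 0 1 2 3 - g 0 1 3 2 - g 0 2 1 3 + g 0 2 3 1 + g 0 3 1 2 := by
    linear_combination - h00
  rw [e0, e1, e2, e3, e4, e5, e6, e7, e8, e9]
  ring

/-! ### The four-by-four minor as a binomial relation -/

section Squares

variable {L : Type u} {R : Type*} [CommRing R] {m : Graph L → R}

/-- The graph with edges from `a i` to `b (c i)`, in addition to those of `E`. -/
def bipartiteGraph {L : Type u} (E : Graph L) (a b : Fin 4 → L) (c₀ c₁ c₂ c₃ : Fin 4) : Graph L :=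
  (a 0, b c₀) ::ₘ (a 1, b c₁) ::ₘ (a 2, b c₂) ::ₘ (a 3, b c₃) ::ₘ E

/-- Two independent expansions `(ab)(xy) = (ax)(by) - (ay)(bx)`, which trade edges inside each of
two vertex sets for edges across them. -/
theorem IsPluecker.two_pairs (hm : IsPluecker m) (E : Graph L) (a b c d x y z w : L) :
    m ((a, b) ::ₘ (c, d) ::ₘ (x, y) ::ₘ (z, w) ::ₘ E) =
      m ((a, x) ::ₘ (b, y) ::ₘ (c, z) ::ₘ (d, w) ::ₘ E)
        - m ((a, x) ::ₘ (b, y) ::ₘ (c, w) ::ₘ (d, z) ::ₘ E)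
        - m ((a, y) ::ₘ (b, x) ::ₘ (c, z) ::ₘ (d, w) ::ₘ E)
        + m ((a, y) ::ₘ (b, x) ::ₘ (c, w) ::ₘ (d, z) ::ₘ E) := by
  have h1 := hm.pluecker ((c, z) ::ₘ (d, w) ::ₘ E) a x b y
  have h2 := hm.pluecker ((c, w) ::ₘ (d, z) ::ₘ E) a x b y
  have h3 := hm.pluecker ((a, b) ::ₘ (x, y) ::ₘ E) c z d w
  have e1 : ∀ p q r s : L × L, p ::ₘ q ::ₘ r ::ₘ s ::ₘ E = r ::ₘ s ::ₘ p ::ₘ q ::ₘ E := by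
    intro p q r s
    rw [Multiset.cons_swap q r, Multiset.cons_swap p r, Multiset.cons_swap q s,
      Multiset.cons_swap p s]
  simp only [e1 (c, z), e1 (c, w), e1 (c, d), Multiset.cons_swap (c, d) (x, y)] at h1 h2 h3 ⊢
  linear_combination -h1 + h2 - h3

/-- The factors of the two-by-two determinant in `sum_sign_sq_eq` are the expansions given by
`two_pairs`. When the eight vertices are distinct and `m` is `matchingVal`, the right side is twice
a simple binomial relation on the four vertices `a i`. -/
theorem IsPluecker.sum_sq (hm : IsPluecker m) (E : Graph L) (a b : Fin 4 → L)
    (g : Fin 4 → Fin 4 → Fin 4 → Fin 4 → R)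
    (hg : ∀ c₀ c₁ c₂ c₃, g c₀ c₁ c₂ c₃ = m (bipartiteGraph E a b c₀ c₁ c₂ c₃)) :
    g 0 1 2 3 ^ 2 - g 0 1 3 2 ^ 2 - g 0 2 1 3 ^ 2 + g 0 2 3 1 ^ 2 + g 0 3 1 2 ^ 2 - g 0 3 2 1
      ^ 2 - g 1 0 2 3 ^ 2 + g 1 0 3 2 ^ 2 + g 1 2 0 3 ^ 2 - g 1 2 3 0 ^ 2 - g 1 3 0 2 ^ 2 + g 1
      3 2 0 ^ 2 + g 2 0 1 3 ^ 2 - g 2 0 3 1 ^ 2 - g 2 1 0 3 ^ 2 + g 2 1 3 0 ^ 2 + g 2 3 0 1 ^ 2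
      - g 2 3 1 0 ^ 2 - g 3 0 1 2 ^ 2 + g 3 0 2 1 ^ 2 + g 3 1 0 2 ^ 2 - g 3 1 2 0 ^ 2 - g 3 2 0
      1 ^ 2 + g 3 2 1 0 ^ 2 =
      2 * (m ((a 0, a 1) ::ₘ (a 2, a 3) ::ₘ (b 0, b 1) ::ₘ (b 2, b 3) ::ₘ E) *
          m ((a 0, a 2) ::ₘ (a 1, a 3) ::ₘ (b 0, b 2) ::ₘ (b 1, b 3) ::ₘ E) -
        m ((a 0, a 1) ::ₘ (a 2, a 3) ::ₘ (b 0, b 2) ::ₘ (b 1, b 3) ::ₘ E) *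
          m ((a 0, a 2) ::ₘ (a 1, a 3) ::ₘ (b 0, b 1) ::ₘ (b 2, b 3) ::ₘ E)) := by
  have row0 : ∀ j x y z, g j x y z - g j x z y - g j y x z + g j y z x + g j z x y - g j z y x
      = 0 := by
    intro j x y z
    have h := hm.six_term ((a 0, b j) ::ₘ E) (a 1) (a 2) (a 3) (b x) (b y) (b z)
    simp only [Multiset.cons_swap _ (a 0, b j)] at h
    simpa only [hg, bipartiteGraph] using h
  have row1 : ∀ j x y z, g x j y z - g x j z y - g y j x z + g y j z x + g z j x y - g z j y x
      = 0 := by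
    intro j x y z
    have h := hm.six_term ((a 1, b j) ::ₘ E) (a 0) (a 2) (a 3) (b x) (b y) (b z)
    simp only [Multiset.cons_swap (a 2, _) (a 1, b j), Multiset.cons_swap (a 3, _) (a 1, b j)] at h
    simpa only [hg, bipartiteGraph] using h
  have row2 : ∀ j x y z, g x y j z - g x z j y - g y x j z + g y z j x + g z x j y - g z y j x
      = 0 := by
    intro j x y z
    have h := hm.six_term ((a 2, b j) ::ₘ E) (a 0) (a 1) (a 3) (b x) (b y) (b z)
    simp only [Multiset.cons_swap (a 3, _) (a 2, b j)] at h
    simpa only [hg, bipartiteGraph] using h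
  rw [sum_sign_sq_eq g (row0 _ _ _ _) (row0 _ _ _ _) (row0 _ _ _ _) (row0 _ _ _ _)
    (row1 _ _ _ _) (row1 _ _ _ _) (row1 _ _ _ _) (row2 _ _ _ _) (row2 _ _ _ _) (row2 _ _ _ _)]
  rw [hm.two_pairs E (a 0) (a 1) (a 2) (a 3) (b 0) (b 1) (b 2) (b 3),
    hm.two_pairs E (a 0) (a 2) (a 1) (a 3) (b 0) (b 2) (b 1) (b 3),
    hm.two_pairs E (a 0) (a 1) (a 2) (a 3) (b 0) (b 2) (b 1) (b 3),
    hm.two_pairs E (a 0) (a 2) (a 1) (a 3) (b 0) (b 1) (b 2) (b 3)]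
  simp only [hg, bipartiteGraph, Multiset.cons_swap (a 2, _) (a 1, _)]

end Squares

/-! ### Matchings encoded as words -/

section Pairs

variable {L : Type u}

/-- The graph whose edges join the first entry of a list to the second one, the third entry to the
fourth one, and so on. -/
def pairs : List L → Graph L
  | a :: b :: l => (a, b) ::ₘ pairs l
  | _ => 0

theorem pairs_append (r : List L) : ∀ (n : ℕ) (l : List L), l.length = 2 * n →
    pairs (l ++ r) = pairs l + pairs r
  | 0, l, h => by
    obtain rfl : l = [] := List.length_eq_zero_iff.1 (by omega)
    simp [pairs]
  | n + 1, [], h => by simp at h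
  | n + 1, [a], h => by simp at h; omega
  | n + 1, a :: b :: l, h => by
    have := pairs_append r n l (by simp at h; omega)
    simp [pairs, this]

/-- Up to the direction of an edge, a given entry can be moved to the front of the list. -/
theorem exists_pairs_eq_cons {z : L} : ∀ (n : ℕ) (t : List L), t.length = 2 * n → z ∈ t →
    ∃ (c : L) (t' : List L), t.Perm (z :: c :: t') ∧ (pairs t = (z, c) ::ₘ pairs t' ∨
      pairs t = (c, z) ::ₘ pairs t')
  | 0, t, h, hz => by
    obtain rfl : t = [] := List.length_eq_zero_iff.1 (by omega)
    simp at hz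
  | n + 1, [], h, hz => by simp at h
  | n + 1, [a], h, hz => by simp at h; omega
  | n + 1, a :: b :: l, h, hz => by
    by_cases ha : z = a
    · subst ha
      exact ⟨b, l, List.Perm.refl _, Or.inl rfl⟩
    by_cases hb : z = b
    · subst hb
      exact ⟨a, l, List.Perm.swap _ _ _, Or.inr rfl⟩
    have hz' : z ∈ l := by simpa [ha, hb] using hz
    obtain ⟨c, t', hp, hE⟩ := exists_pairs_eq_cons n l (by simp at h; omega) hz'
    refine ⟨c, a :: b :: t', ?_, ?_⟩
    · refine ((hp.cons b).cons a).trans ?_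
      exact List.perm_append_comm_assoc [a, b] [z, c] t'
    · simp only [pairs]
      rcases hE with hE | hE
      · left
        rw [hE, Multiset.cons_swap]
      · right
        rw [hE, Multiset.cons_swap]

end Pairs

/-! ### Rotation against transposition -/

section Cyclic

variable {L : Type u} {M : Type*} [AddCommGroup M]

/-- A function on words of even length which is invariant under cyclic rotations and changes its
sign when the first two letters are exchanged is killed by two. -/
theorem add_self_eq_zero_of_rotate {F : List L → M} {N : ℕ} (hN : Even N)
    (hrot : ∀ (x : L) (l : List L), l.length + 1 = N → F (l ++ [x]) = F (x :: l))
    (hswap : ∀ (x y : L) (l : List L), l.length + 2 = N → F (x :: y :: l) = -F (y :: x :: l))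
    (x : L) (l : List L) (hl : l.length + 1 = N) : F (x :: l) + F (x :: l) = 0 := by
  have hcomm : ∀ r s : List L, (r ++ s).length = N → F (r ++ s) = F (s ++ r) := by
    intro r
    induction r with
    | nil => intro s _; simp
    | cons y r ih =>
      intro s hs
      have h1 := hrot y (r ++ s) (by simpa using hs)
      have h2 := ih (s ++ [y]) (by simp at hs ⊢; omega)
      rw [List.cons_append, ← h1, List.append_assoc, h2]
      simp
  have hswap' : ∀ (s : List L) (y z : L) (r : List L), (s ++ y :: z :: r).length = N →
      F (s ++ y :: z :: r) = -F (s ++ z :: y :: r) := by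
    intro s y z r h
    rw [hcomm s _ h, hcomm s _ (by simpa using h)]
    exact hswap y z (r ++ s) (by simp at h ⊢; omega)
  have hmove : ∀ (r s : List L), (s ++ x :: r).length = N →
      F (s ++ x :: r) = (-1 : ℤ) ^ r.length • F (s ++ r ++ [x]) := by
    intro r
    induction r with
    | nil => intro s _; simp
    | cons y r ih =>
      intro s h
      have h1 := ih (s ++ [y]) (by simp at h ⊢; omega)
      rw [hswap' s x y r h, List.length_cons, pow_succ]
      simp only [List.append_assoc, List.cons_append, List.nil_append] at h1 ⊢
      rw [h1]
      simp
  -- Carrying the first letter to the end takes `l.length` adjacent swaps, an odd number, while the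
  -- result is a rotation and has the same value.
  have h := hmove l [] (by simpa using hl)
  have hodd : Odd l.length := by
    rw [← hl, Nat.even_add_one] at hN
    exact Nat.not_even_iff_odd.1 hN
  rw [hodd.neg_one_pow, List.nil_append, List.nil_append, hrot x l hl] at h
  nth_rewrite 1 [h]
  simp

end Cyclic

/-- A symmetric form on graphs which satisfies the sign and Plücker relations in each variable and
vanishes on the diagonal. -/
structure IsNullForm {L : Type u} {M : Type*} [AddCommGroup M] (B : Graph L → Graph L → M) :
    Prop where
  left : ∀ Δ, IsPluecker (B · Δ)
  symm : ∀ Γ Δ, B Γ Δ = B Δ Γ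
  self : ∀ Γ, B Γ Γ = 0

/-! ### Polarization: forms vanishing on the diagonal -/

section NullForm

variable {L : Type u} {M : Type*} [AddCommGroup M] {B : Graph L → Graph L → M}

theorem IsPluecker.comp_cons {m : Graph L → M} (hm : IsPluecker m) (e : L × L) :
    IsPluecker fun Γ => m (e ::ₘ Γ) where
  sign E a b := by
    simpa only [Multiset.cons_swap _ e] using hm.sign (e ::ₘ E) a b
  pluecker E a b c d := by
    simpa only [Multiset.cons_swap _ e] using hm.pluecker (e ::ₘ E) a b c d

theorem IsNullForm.right (hB : IsNullForm B) (Γ : Graph L) : IsPluecker fun Δ => B Γ Δ := by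
  simpa only [hB.symm Γ] using hB.left Γ

/-- A common edge of two matchings can be absorbed into the form; this drives the induction on the
number of edges. -/
theorem IsNullForm.comp_cons (hB : IsNullForm B) (e : L × L) :
    IsNullForm fun Γ Δ => B (e ::ₘ Γ) (e ::ₘ Δ) where
  left Δ := (hB.left (e ::ₘ Δ)).comp_cons e
  symm _ _ := hB.symm _ _
  self _ := hB.self _

/-- If the form vanishes on pairs of matchings with a common edge, then it vanishes on pairs of
matchings which form a Hamiltonian cycle. -/
theorem IsNullForm.eq_zero_of_cycle (hB : IsNullForm B) (h2 : ∀ x : M, x + x = 0 → x = 0) {n : ℕ}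
    (hshare : ∀ (a b : L) (l l' : List L), l.Perm l' → l.length = 2 * n →
      B ((a, b) ::ₘ pairs l) ((a, b) ::ₘ pairs l') = 0)
    (l : List L) (hl : l.length = 2 * n + 2) : B (pairs l) (pairs (l.rotate 1)) = 0 := by
  rcases n with _ | n
  · match l, hl with
    | [x, y], _ =>
      have h := (hB.right {(x, y)}).sign 0 y x
      have h' := hB.self {(x, y)}
      simp only [pairs, List.rotate_cons_succ, List.rotate_zero, List.nil_append,
        List.cons_append, Multiset.cons_zero] at h ⊢
      rw [h, h', neg_zero]
  -- Plücker on `(x, y), (z, w)` gives one term sharing the edge `yz` with the other matching, hence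
  -- zero, and one term belonging to the word with `y` and `z` exchanged; reversing `yz` in the
  -- other matching gives the sign.
  have swap_middle : ∀ (x y z w : L) (t : List L), t.length = 2 * n →
      B (pairs (x :: y :: z :: w :: t)) (pairs ((x :: y :: z :: w :: t).rotate 1)) =
        -B (pairs (x :: z :: y :: w :: t)) (pairs ((x :: z :: y :: w :: t).rotate 1)) := by
    intro x y z w t ht
    simp only [pairs, List.rotate_cons_succ, List.rotate_zero, List.cons_append]
    have h1 := (hB.left ((y, z) ::ₘ pairs (w :: (t ++ [x])))).pluecker (pairs t) x y z w
    have h2 := hshare y z (x :: w :: t) (w :: (t ++ [x]))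
      (by simpa using (List.perm_append_singleton x (w :: t)).symm) (by simp; omega)
    have h3 := (hB.left ((y, z) ::ₘ pairs (w :: (t ++ [x])))).sign ((x, w) ::ₘ pairs t) z y
    have h4 := (hB.right ((x, z) ::ₘ (y, w) ::ₘ pairs t)).sign (pairs (w :: (t ++ [x]))) y z
    simp only [pairs] at h1 h2 h3 h4
    rw [h1, Multiset.cons_swap (x, w) (z, y), h3, h2, h4]
    simp
  -- A rotation by one letter exchanges the two matchings of the cycle, so this is the symmetry of
  -- the form.
  have hrot : ∀ (x : L) (l : List L), l.length + 1 = 2 * (n + 1) + 2 →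
      B (pairs (l ++ [x])) (pairs ((l ++ [x]).rotate 1)) =
        B (pairs (x :: l)) (pairs ((x :: l).rotate 1)) := by
    intro x l hl
    match l, hl with
    | y :: l, hl =>
      have h := pairs_append [x, y] (n + 1) l (by simp at hl; omega)
      simp only [List.rotate_cons_succ, List.rotate_zero, List.cons_append, List.append_assoc,
        List.nil_append, h, pairs]
      rw [hB.symm, add_comm (pairs l), Multiset.cons_add, zero_add]
  match l, hl with
  | x :: l, hl =>
    refine h2 _ (add_self_eq_zero_of_rotate
      (F := fun l => B (pairs l) (pairs (l.rotate 1))) (N := 2 * (n + 1) + 2)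
      (by simp [parity_simps]) hrot ?_ x l (by simpa using hl))
    intro x y l hl
    obtain ⟨l, w, rfl⟩ : ∃ l' w, l = l' ++ [w] :=
      ⟨l.dropLast, l.getLast (by rintro rfl; simp at hl),
        (List.dropLast_append_getLast _).symm⟩
    match l, hl with
    | z :: l, hl =>
      have h1 := hrot w (x :: y :: z :: l) (by simp at hl ⊢; omega)
      have h2 := hrot w (y :: x :: z :: l) (by simp at hl ⊢; omega)
      have h3 := swap_middle w x y z l (by simp at hl; omega)
      exact (h1.trans h3).trans (congrArg _ h2.symm)
    | [], hl => simp at hl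

/-- The form vanishes if it vanishes on Hamiltonian cycles: an alternating path in the union of two
matchings can be extended until it is Hamiltonian. -/
theorem IsNullForm.eq_zero_of_path (hB : IsNullForm B) {n : ℕ}
    (hcycle : ∀ l : List L, l.length = 2 * n + 2 → B (pairs l) (pairs (l.rotate 1)) = 0) :
    ∀ (k j : ℕ) (a z : L) (q s t : List L), q.length = 2 * j → s.length = 2 * k → k + j = n →
      t.Perm (a :: z :: s) →
      B (pairs (a :: (q ++ [z])) + pairs s) (pairs q + pairs t) = 0 := by
  have hflip : ∀ (Γ Δ E : Graph L) (x y : L), B Γ (Δ + (x, y) ::ₘ E) = 0 →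
      B Γ (Δ + (y, x) ::ₘ E) = 0 := by
    intro Γ Δ E x y h
    rw [Multiset.add_cons] at h ⊢
    rw [(hB.right Γ).sign, h, neg_zero]
  intro k
  induction k with
  | zero =>
    intro j a z q s t hq hs hn ht
    -- The path `a, q, z` exhausts the vertices, and the only edge in `t` closes it to a Hamiltonian
    -- cycle.
    obtain rfl : s = [] := List.length_eq_zero_iff.1 (by omega)
    have hlen := ht.length_eq
    obtain ⟨c, t', hp, hE⟩ := exists_pairs_eq_cons (z := z) 1 t (by simpa using hlen)
      (ht.mem_iff.2 (by simp))
    obtain rfl : t' = [] := by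
      have := hp.length_eq
      exact List.length_eq_zero_iff.1 (by simp at this hlen; omega)
    obtain rfl : c = a := by
      have h1 : [z, c].Perm [z, a] := hp.symm.trans (ht.trans (List.Perm.swap _ _ _))
      simpa using h1
    have h := hcycle (c :: (q ++ [z])) (by simp; omega)
    have h1 := pairs_append [z, c] j q hq
    simp only [List.rotate_cons_succ, List.rotate_zero, List.append_assoc, List.cons_append,
      List.nil_append, h1, pairs] at h
    simp only [pairs, add_zero] at hE ⊢
    rcases hE with hE | hE
    · rw [hE]; exact h
    · rw [hE]; exact hflip _ _ _ _ _ h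
  | succ k ih =>
    intro j a z q s t hq hs hn ht
    -- If the partner `c` of `z` in the second matching lies off the path, then `c` and its partner
    -- `d` in the first matching lengthen the path.
    have hmem : ∀ (c : L) (t' : List L), (c :: t').Perm (a :: s) → c ∈ s →
        B (pairs (a :: (q ++ [z])) + pairs s) (pairs q + (z, c) ::ₘ pairs t') = 0 := by
      intro c t' hp hc
      obtain ⟨d, s', hs', hE⟩ := exists_pairs_eq_cons (k + 1) s hs hc
      have hlen := hs'.length_eq
      have ht' : t'.Perm (a :: d :: s') := by
        have : (c :: t').Perm (c :: a :: d :: s') :=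
          hp.trans ((hs'.cons a).trans (List.Perm.swap _ _ _))
        exact this.cons_inv
      have h := ih (j + 1) a d (q ++ [z, c]) s' t' (by simp; omega)
        (by simp at hlen; omega) (by omega) ht'
      have h1 := pairs_append [z, c] j q hq
      have h2 := pairs_append [c, d] (j + 1) (a :: (q ++ [z])) (by simp; omega)
      have h3 : a :: (q ++ [z, c] ++ [d]) = a :: (q ++ [z]) ++ [c, d] := by simp
      rw [h3, h2, h1, add_assoc, add_assoc] at h
      simp only [pairs, Multiset.cons_add, zero_add] at h
      rcases hE with hE | hE
      · rw [hE]; exact h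
      · rw [hE, hB.symm]
        rw [hB.symm] at h
        exact hflip _ _ _ _ _ h
    have hlen := ht.length_eq
    obtain ⟨c, t', hp, hE⟩ := exists_pairs_eq_cons (z := z) (k + 2) t
      (by simp at hlen; omega) (ht.mem_iff.2 (by simp))
    suffices h : B (pairs (a :: (q ++ [z])) + pairs s) (pairs q + (z, c) ::ₘ pairs t') = 0 by
      rcases hE with hE | hE
      · rw [hE]; exact h
      · rw [hE]; exact hflip _ _ _ _ _ h
    have hp' : (c :: t').Perm (a :: s) := by
      have : (z :: c :: t').Perm (z :: a :: s) := hp.symm.trans (ht.trans (List.Perm.swap _ _ _))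
      exact this.cons_inv
    by_cases hc : c ∈ s
    · exact hmem c t' hp' hc
    -- The path closes up too early. A Plücker move on the closing edge and another edge `(b, d)` of
    -- the second matching gives two terms in which `z` is joined to `d` or to `b`, both off the
    -- path.
    obtain rfl : c = a := by
      have : c ∈ a :: s := hp'.mem_iff.1 (by simp)
      simpa [hc] using this
    have ht' := hp'.cons_inv
    have hlen' := ht'.length_eq
    match t', ht', hlen' with
    | b :: d :: t', ht', _ =>
      have h1 := hmem d (b :: c :: t')
        (((List.perm_append_comm_assoc [d, b] [c] t').trans
          ((List.Perm.swap _ _ _).cons c)).trans (ht'.cons c)) (ht'.mem_iff.1 (by simp))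
      have h2 := hmem b (c :: d :: t') ((List.Perm.swap _ _ _).trans (ht'.cons c))
        (ht'.mem_iff.1 (by simp))
      have h3 := (hB.right (pairs (c :: (q ++ [z])) + pairs s)).pluecker
        (pairs q + pairs t') z c b d
      simp only [pairs, Multiset.add_cons] at h1 h2 h3 ⊢
      rw [h3, h1, h2, add_zero]
    | [], _, h => simp at h; omega
    | [b], _, h => simp at h; omega

/-- If the values of the form have no two-torsion, then the form vanishes on pairs of matchings of
the same vertices. -/
theorem IsNullForm.eq_zero (h2 : ∀ x : M, x + x = 0 → x = 0) :
    ∀ (n : ℕ) {B : Graph L → Graph L → M}, IsNullForm B → ∀ l l' : List L, l.Perm l' →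
      l.length = 2 * n → B (pairs l) (pairs l') = 0
  | 0, B, hB, l, l', hp, hl => by
    obtain rfl : l = [] := List.length_eq_zero_iff.1 (by omega)
    obtain rfl := hp.nil_eq
    exact hB.self _
  | n + 1, B, hB, l, l', hp, hl => by
    match l, hl with
    | a :: z :: s, hl =>
      -- The initial path is the single edge `(a, z)`, with empty interior.
      have h := hB.eq_zero_of_path (n := n)
        (hB.eq_zero_of_cycle h2 fun a b l l' hp hl => IsNullForm.eq_zero h2 n
          (hB.comp_cons (a, b)) l l' hp hl) n 0 a z [] s l' rfl (by simp at hl; omega) (by omega)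
          hp.symm
      simpa [pairs] using h

end NullForm

/-! ### Valences -/

section Valence

variable {L : Type u}

open scoped Classical in
theorem valence_cons (a b : L) (E : Graph L) (v : L) :
    valence ((a, b) ::ₘ E) v = valence E v + (if v = a then 1 else 0) + if v = b then 1 else 0 := by
  simp only [valence, Multiset.map_cons, Multiset.count_cons]
  omega

theorem valence_cons_swap (a b : L) (E : Graph L) (v : L) :
    valence ((b, a) ::ₘ E) v = valence ((a, b) ::ₘ E) v := by
  simp only [valence_cons]
  omega

theorem isRegular_cons_swap {k : ℕ} {a b : L} {E : Graph L} :
    IsRegular k ((b, a) ::ₘ E) ↔ IsRegular k ((a, b) ::ₘ E) := by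
  simp only [IsRegular, valence_cons_swap a b]

end Valence

/-! ### Matchings as elements of the symmetric algebra -/

section MatchingVal

variable {L : Type u}

open scoped Classical in
/-- The class of `X_Γ` in `Sym(V_L)` if `Γ` is a matching, and zero otherwise. -/
def matchingVal (Γ : Graph L) : SymmetricAlgebra ℤ (V L) :=
  if h : IsRegular 1 Γ then symElt Γ h else 0

theorem matchingVal_of_regular {Γ : Graph L} (h : IsRegular 1 Γ) : matchingVal Γ = symElt Γ h :=
  dif_pos h

theorem X_eq_zero_of_relation {r : GraphAlgebra L} (h : IsGraphRelation r) :
    Ideal.Quotient.mk (Ideal.span {r : GraphAlgebra L | IsGraphRelation r}) r = 0 :=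
  Ideal.Quotient.eq_zero_iff_mem.2 (Ideal.subset_span h)

/-- The default value zero is harmless: the graphs in a sign or Plücker relation have equal
valences, so all of them are matchings or none is. -/
theorem isPluecker_matchingVal : IsPluecker (matchingVal : Graph L → _) where
  sign E a b := by
    by_cases h : IsRegular 1 ((a, b) ::ₘ E)
    · have h' := isRegular_cons_swap.2 h
      rw [matchingVal_of_regular h, matchingVal_of_regular h', symElt, symElt, ← map_neg]
      congr 1
      refine Subtype.ext ?_
      have := X_eq_zero_of_relation (IsGraphRelation.sign (⟨_, 1, h⟩ : regularGraphs L)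
        ⟨_, 1, h'⟩ E a b (by simp [← Multiset.singleton_add, add_comm])
        (by simp [← Multiset.singleton_add, add_comm]))
      rw [map_add] at this
      exact eq_neg_of_add_eq_zero_left this
    · rw [matchingVal, dif_neg h, matchingVal, dif_neg (mt isRegular_cons_swap.1 h), neg_zero]
  pluecker E a b c d := by
    have e1 : ∀ v, valence ((a, d) ::ₘ (c, b) ::ₘ E) v = valence ((a, b) ::ₘ (c, d) ::ₘ E) v := by
      intro v; simp only [valence_cons]; omega
    have e2 : ∀ v, valence ((a, c) ::ₘ (b, d) ::ₘ E) v = valence ((a, b) ::ₘ (c, d) ::ₘ E) v := by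
      intro v; simp only [valence_cons]; omega
    by_cases h : IsRegular 1 ((a, b) ::ₘ (c, d) ::ₘ E)
    · have h1 : IsRegular 1 ((a, d) ::ₘ (c, b) ::ₘ E) := fun v => (e1 v).trans (h v)
      have h2 : IsRegular 1 ((a, c) ::ₘ (b, d) ::ₘ E) := fun v => (e2 v).trans (h v)
      rw [matchingVal_of_regular h, matchingVal_of_regular h1, matchingVal_of_regular h2, symElt,
        symElt, symElt, ← map_add]
      congr 1
      refine Subtype.ext ?_
      have e : ∀ p q : L × L, p ::ₘ q ::ₘ E = E + {p, q} := fun p q => by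
        rw [Multiset.insert_eq_cons, Multiset.add_cons, add_comm, Multiset.singleton_add]
      have := X_eq_zero_of_relation (IsGraphRelation.pluecker (⟨_, 1, h⟩ : regularGraphs L)
        ⟨_, 1, h1⟩ ⟨_, 1, h2⟩ E a b c d (e _ _) (e _ _) (e _ _))
      rw [map_sub, map_add] at this
      exact sub_eq_zero.1 this
    · have h1 : ¬ IsRegular 1 ((a, d) ::ₘ (c, b) ::ₘ E) := fun h1 =>
        h fun v => (e1 v).symm.trans (h1 v)
      have h2 : ¬ IsRegular 1 ((a, c) ::ₘ (b, d) ::ₘ E) := fun h2 =>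
        h fun v => (e2 v).symm.trans (h2 v)
      rw [matchingVal, dif_neg h, matchingVal, dif_neg h1, matchingVal, dif_neg h2, add_zero]

end MatchingVal

/-! ### Saturation at two -/

section Saturation

/-- The elements with a multiple by a power of two in the given submodule. -/
def twoSaturation {M : Type*} [AddCommGroup M] (P : Submodule ℤ M) : Submodule ℤ M where
  carrier := {x | ∃ k : ℕ, (2 ^ k : ℤ) • x ∈ P}
  zero_mem' := ⟨0, by simp⟩
  add_mem' := by
    rintro x y ⟨k, hk⟩ ⟨j, hj⟩
    refine ⟨k + j, ?_⟩
    have h1 := P.smul_mem (2 ^ j : ℤ) hk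
    have h2 := P.smul_mem (2 ^ k : ℤ) hj
    have := P.add_mem h1 h2
    rwa [smul_smul, smul_smul, ← pow_add, ← pow_add, add_comm j k, ← smul_add] at this
  smul_mem' := by
    rintro c x ⟨k, hk⟩
    exact ⟨k, by rw [smul_comm]; exact P.smul_mem c hk⟩

theorem le_twoSaturation {M : Type*} [AddCommGroup M] (P : Submodule ℤ M) : P ≤ twoSaturation P :=
  fun x hx => ⟨0, by simpa using hx⟩

theorem mem_twoSaturation_of_two_smul {M : Type*} [AddCommGroup M] {P : Submodule ℤ M} {x : M}
    (h : (2 : ℤ) • x ∈ twoSaturation P) : x ∈ twoSaturation P := by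
  obtain ⟨k, hk⟩ := h
  exact ⟨k + 1, by rwa [pow_succ, mul_smul]⟩

theorem eq_zero_of_add_self_quotient {M : Type*} [AddCommGroup M] {P : Submodule ℤ M}
    (h2 : ∀ x, (2 : ℤ) • x ∈ P → x ∈ P) (x : M ⧸ P) (hx : x + x = 0) : x = 0 := by
  obtain ⟨y, rfl⟩ := P.mkQ_surjective x
  rw [← map_add, ← two_smul ℤ] at hx
  exact (Submodule.Quotient.mk_eq_zero _).2 (h2 y ((Submodule.Quotient.mk_eq_zero _).1 hx))

end Saturation

/-! ### Squares span the products up to powers of two -/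

section Products

variable {L : Type u}

theorem exists_pairs_eq (Γ : Graph L) : ∃ l : List L, pairs l = Γ ∧ l.length = 2 * Γ.card ∧
    (l : Multiset L) = Γ.map Prod.fst + Γ.map Prod.snd := by
  induction Γ using Multiset.induction with
  | empty => exact ⟨[], rfl, rfl, rfl⟩
  | cons e E ih =>
    obtain ⟨l, h, hl, hm⟩ := ih
    refine ⟨e.1 :: e.2 :: l, by simp [pairs, h], by simp [hl]; ring, ?_⟩
    rw [← Multiset.cons_coe, ← Multiset.cons_coe, hm]
    simp [Multiset.cons_swap]

/-- A two-saturated submodule which contains the squares of all matchings contains all products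
of two matchings. -/
theorem matchingVal_mul_mem {P : Submodule ℤ (SymmetricAlgebra ℤ (V L))}
    (h2 : ∀ x, (2 : ℤ) • x ∈ P → x ∈ P) (hsq : ∀ Γ : Graph L, matchingVal Γ ^ 2 ∈ P)
    (Γ Δ : Graph L) (hΓ : IsRegular 1 Γ) (hΔ : IsRegular 1 Δ) :
    matchingVal Γ * matchingVal Δ ∈ P := by
  have hB : IsNullForm fun Γ Δ : Graph L => P.mkQ (matchingVal Γ * matchingVal Δ) :=
    { left := fun Δ =>
        { sign := fun E a b => by
            rw [isPluecker_matchingVal.sign E a b, neg_mul, map_neg]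
          pluecker := fun E a b c d => by
            rw [isPluecker_matchingVal.pluecker E a b c d, add_mul, map_add] }
      symm := fun Γ Δ => by rw [mul_comm]
      self := fun Γ => by
        rw [← pow_two]
        exact (Submodule.Quotient.mk_eq_zero _).2 (hsq Γ) }
  obtain ⟨l, rfl, hl, hm⟩ := exists_pairs_eq Γ
  obtain ⟨l', rfl, -, hm'⟩ := exists_pairs_eq Δ
  have hp : l.Perm l' := by
    classical
    rw [← Multiset.coe_eq_coe, hm, hm']
    ext v
    have h1 := hΓ v
    have h2 := hΔ v
    simp only [valence] at h1 h2
    rw [Multiset.count_add, Multiset.count_add]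
    convert h1.trans h2.symm
  exact (Submodule.Quotient.mk_eq_zero _).1
    (IsNullForm.eq_zero (eq_zero_of_add_self_quotient h2) _ hB l l' hp hl)

theorem symPiece_two_le {P : Submodule ℤ (SymmetricAlgebra ℤ (V L))}
    (h2 : ∀ x, (2 : ℤ) • x ∈ P → x ∈ P) (hsq : ∀ Γ : Graph L, matchingVal Γ ^ 2 ∈ P) :
    symPiece L 2 ≤ P := by
  have hrange : LinearMap.range (SymmetricAlgebra.ι ℤ (V L)) ≤
      Submodule.span ℤ {x | ∃ Γ : Graph L, IsRegular 1 Γ ∧ x = matchingVal Γ} := by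
    rintro _ ⟨⟨x, hx⟩, rfl⟩
    induction hx using Submodule.span_induction with
    | mem x hx =>
      obtain ⟨Γ, hΓ, rfl⟩ := hx
      exact Submodule.subset_span ⟨Γ, hΓ, (matchingVal_of_regular hΓ).symm⟩
    | zero => exact (map_zero (SymmetricAlgebra.ι ℤ (V L))).symm ▸ Submodule.zero_mem _
    | add x y hx hy h1 h2 =>
      have := Submodule.add_mem _ h1 h2
      rwa [← map_add] at this
    | smul c x hx h1 =>
      have := Submodule.smul_mem _ c h1
      rwa [← map_smul] at this
  rw [symPiece, pow_two]
  refine (mul_le_mul' hrange hrange).trans ?_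
  rw [Submodule.span_mul_span, Submodule.span_le]
  rintro _ ⟨_, ⟨Γ, hΓ, rfl⟩, _, ⟨Δ, hΔ, rfl⟩, rfl⟩
  exact matchingVal_mul_mem h2 hsq Γ Δ hΓ hΔ

end Products

/-! ### Evaluation at points of the projective line -/

section Evaluation

variable {L : Type u}

/-- The value of a graph at points with homogeneous coordinates `u`, `v`. -/
def graphEval (u v : L → ℚ) (Γ : Graph L) : ℚ :=
  (Γ.map fun e => u e.1 * v e.2 - u e.2 * v e.1).prod

/-- The evaluation of invariants at points with homogeneous coordinates `u`, `v`. -/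
def algebraEval (u v : L → ℚ) : GraphAlgebra L →ₐ[ℤ] ℚ :=
  AddMonoidAlgebra.lift ℤ ℚ (regularGraphs L)
    { toFun := fun Γ => graphEval u v (Multiplicative.toAdd Γ : regularGraphs L)
      map_one' := by simp [graphEval]
      map_mul' := fun Γ Δ => by simp [graphEval] }

theorem algebraEval_graphElt (u v : L → ℚ) (Γ : regularGraphs L) :
    algebraEval u v (graphElt Γ) = graphEval u v Γ := by
  simp only [algebraEval, graphElt, AddMonoidAlgebra.lift_single, one_smul]
  rfl

theorem algebraEval_relation (u v : L → ℚ) {r : GraphAlgebra L} (hr : IsGraphRelation r) :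
    algebraEval u v r = 0 := by
  cases hr with
  | loop Γ a h =>
    rw [algebraEval_graphElt, graphEval, Multiset.prod_eq_zero_iff]
    exact Multiset.mem_map.2 ⟨_, h, by ring⟩
  | sign Γ Γ' E a b h h' =>
    rw [map_add, algebraEval_graphElt, algebraEval_graphElt, h, h']
    simp only [graphEval, Multiset.map_add, Multiset.prod_add, Multiset.map_singleton,
      Multiset.prod_singleton]
    ring
  | pluecker Γ Γ' Γ'' E a b c d h h' h'' =>
    rw [map_sub, map_add, algebraEval_graphElt, algebraEval_graphElt, algebraEval_graphElt,
      h, h', h'']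
    simp only [graphEval, Multiset.map_add, Multiset.prod_add, Multiset.insert_eq_cons,
      Multiset.map_cons, Multiset.prod_cons, Multiset.map_singleton, Multiset.prod_singleton]
    ring

/-- The evaluation at points with homogeneous coordinates `u`, `v`, as a homomorphism from `R_L`. -/
def ringEval (u v : L → ℚ) : InvariantRing L →+* ℚ :=
  Ideal.Quotient.lift _ (algebraEval u v : GraphAlgebra L →+* ℚ) fun a ha => by
    have : Ideal.span {r : GraphAlgebra L | IsGraphRelation r} ≤
        RingHom.ker (algebraEval u v : GraphAlgebra L →+* ℚ) :=
      Ideal.span_le.2 fun r hr => algebraEval_relation u v hr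
    exact this ha

theorem ringEval_symToRing_matchingVal (u v : L → ℚ) {Γ : Graph L} (h : IsRegular 1 Γ) :
    ringEval u v (symToRing L (matchingVal Γ)) = graphEval u v Γ := by
  rw [matchingVal_of_regular h, symElt, symToRing, SymmetricAlgebra.lift_ι_apply]
  exact algebraEval_graphElt u v ⟨Γ, 1, h⟩

end Evaluation

/-! ### The minors and the simple binomial relations -/

section Binomials

variable {L : Type u}

/-- The two-saturation of the span of the simple binomial relations. -/
def binomialSpan (L : Type u) : Submodule ℤ (SymmetricAlgebra ℤ (V L)) :=
  twoSaturation (Submodule.span ℤ {x | IsSimpleBinomial x})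

open scoped Classical in
theorem valence_bipartiteGraph (E : Graph L) (a b : Fin 4 → L) (c : Fin 4 → Fin 4) (v : L) :
    valence (bipartiteGraph E a b (c 0) (c 1) (c 2) (c 3)) v = valence E v +
      (∑ i, if v = a i then 1 else 0) + (∑ i, if v = b (c i) then 1 else 0) := by
  simp only [bipartiteGraph, valence_cons, Fin.sum_univ_four]
  omega

/-- Here `U` is the range of `a`, and the `b` edges together with `E` form the matchings on the
complement. Regularity of the bipartite graph forces the `a i` to be distinct and disjoint from the
rest. -/
theorem binomial_mem (E : Graph L) (a b : Fin 4 → L)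
    (h : IsRegular 1 (bipartiteGraph E a b 0 1 2 3)) :
    matchingVal ((a 0, a 1) ::ₘ (a 2, a 3) ::ₘ (b 0, b 1) ::ₘ (b 2, b 3) ::ₘ E) *
        matchingVal ((a 0, a 2) ::ₘ (a 1, a 3) ::ₘ (b 0, b 2) ::ₘ (b 1, b 3) ::ₘ E) -
      matchingVal ((a 0, a 1) ::ₘ (a 2, a 3) ::ₘ (b 0, b 2) ::ₘ (b 1, b 3) ::ₘ E) *
        matchingVal ((a 0, a 2) ::ₘ (a 1, a 3) ::ₘ (b 0, b 1) ::ₘ (b 2, b 3) ::ₘ E) ∈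
      binomialSpan L := by
  classical
  have hval : ∀ v, valence E v + (∑ i, if v = a i then 1 else 0) +
      (∑ i, if v = b i then 1 else 0) = 1 := by
    intro v
    exact (valence_bipartiteGraph E a b id v).symm.trans (h v)
  have hmem : ∀ v ∈ Set.range a, (∑ i, if v = a i then 1 else 0) = 1 := by
    rintro _ ⟨i, rfl⟩
    have h1 := hval (a i)
    have h2 : (if a i = a i then 1 else 0) ≤ ∑ j, if a i = a j then 1 else 0 :=
      Finset.single_le_sum (f := fun j => if a i = a j then 1 else 0) (fun _ _ => by positivity)
        (Finset.mem_univ i)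
    rw [if_pos rfl] at h2
    omega
  have hnot : ∀ v ∉ Set.range a, (∑ i, if v = a i then 1 else 0) = 0 := by
    intro v hv
    refine Finset.sum_eq_zero fun i _ => if_neg ?_
    rintro rfl
    exact hv ⟨i, rfl⟩
  have hinj : Function.Injective a := by
    intro i j hij
    by_contra hne
    have h1 := hmem (a i) ⟨i, rfl⟩
    have h2 : ∑ k ∈ {i, j}, (if a i = a k then 1 else 0) ≤ ∑ k, if a i = a k then 1 else 0 :=
      Finset.sum_le_sum_of_subset (Finset.subset_univ _)
    rw [Finset.sum_pair hne, if_pos rfl, if_pos hij] at h2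
    omega
  have hcard : (Set.range a).ncard = 4 := by
    rw [Set.ncard_range_of_injective hinj]
    simp
  have hv0 : ∀ v, valence (0 : Graph L) v = 0 := valence_zero
  have hA : ∀ i j k l : Fin 4, (∀ v, (∑ i, if v = a i then 1 else 0) = (if v = a i then 1 else 0) +
      (if v = a j then 1 else 0) + (if v = a k then 1 else 0) + if v = a l then 1 else 0) →
      IsMatchingOn (Set.range a) ((a i, a j) ::ₘ (a k, a l) ::ₘ 0) := by
    intro i j k l hs
    refine ⟨fun v hv => ?_, fun v hv => ?_⟩
    · have h1 := hmem v hv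
      rw [hs] at h1
      simp only [valence_cons, hv0]
      omega
    · have h1 := hnot v hv
      rw [hs] at h1
      simp only [valence_cons, hv0]
      omega
  have hB : ∀ i j k l : Fin 4, (∀ v, (∑ i, if v = b i then 1 else 0) = (if v = b i then 1 else 0) +
      (if v = b j then 1 else 0) + (if v = b k then 1 else 0) + if v = b l then 1 else 0) →
      IsMatchingOn (Set.range a)ᶜ ((b i, b j) ::ₘ (b k, b l) ::ₘ E) := by
    intro i j k l hs
    refine ⟨fun v hv => ?_, fun v hv => ?_⟩
    · have h1 := hnot v hv
      have h2 := hval v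
      rw [hs, h1] at h2
      simp only [valence_cons]
      omega
    · have h1 := hmem v (by simpa using hv)
      have h2 := hval v
      rw [hs, h1] at h2
      simp only [valence_cons]
      omega
  have hA1 := hA 0 1 2 3 fun v => Fin.sum_univ_four _
  have hA2 := hA 0 2 1 3 fun v => by rw [Fin.sum_univ_four]; omega
  have hB1 := hB 0 1 2 3 fun v => Fin.sum_univ_four _
  have hB2 := hB 0 2 1 3 fun v => by rw [Fin.sum_univ_four]; omega
  have e : ∀ p q : L × L, ∀ F : Graph L, p ::ₘ q ::ₘ F = F + (p ::ₘ q ::ₘ 0) := fun p q F => by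
    rw [Multiset.add_cons, Multiset.add_cons, add_zero]
  rw [e _ _ ((b 0, b 1) ::ₘ _), e _ _ ((b 0, b 2) ::ₘ _), e _ _ ((b 0, b 2) ::ₘ _),
    e _ _ ((b 0, b 1) ::ₘ _), matchingVal_of_regular (hB1.union hA1),
    matchingVal_of_regular (hB2.union hA2),
    matchingVal_of_regular (hB2.union hA1), matchingVal_of_regular (hB1.union hA2),
    mul_comm (symElt _ (hB2.union hA1))]
  exact le_twoSaturation _ (Submodule.subset_span
    (IsSimpleBinomial.mk _ hcard _ _ _ _ hA1 hA2 hB1 hB2))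

end Binomials

/-! ### Straightening squares to standard matchings -/

section Straightening

variable {L : Type u} (pos : L → ℕ)

/-- The sum over the edges of the products of the positions of the two ends. -/
def potential (Γ : Graph L) : ℕ := (Γ.map fun e => pos e.1 * pos e.2).sum

theorem potential_cons (e : L × L) (Γ : Graph L) :
    potential pos (e ::ₘ Γ) = pos e.1 * pos e.2 + potential pos Γ := by
  simp [potential]

theorem potential_bipartiteGraph (E : Graph L) (a b : Fin 4 → L) (c : Fin 4 → Fin 4) :
    potential pos (bipartiteGraph E a b (c 0) (c 1) (c 2) (c 3)) =
      (∑ i, pos (a i) * pos (b (c i))) + potential pos E := by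
  simp only [bipartiteGraph, potential_cons, Fin.sum_univ_four]
  ring

variable {pos}

/-- Strict rearrangement inequality: equality would make `σ` order-preserving, hence the identity.
-/
theorem sum_mul_perm_lt {f g : Fin 4 → ℕ} (hf : StrictMono f) (hg : StrictMono g)
    {σ : Equiv.Perm (Fin 4)} (hσ : σ ≠ 1) : ∑ i, f i * g (σ i) < ∑ i, f i * g i := by
  have hmono : Monovary f g := hf.monotone.monovary hg.monotone
  refine hmono.sum_mul_comp_perm_lt_sum_mul_iff.2 fun h => hσ ?_
  have h1 : ∀ i j, σ i < σ j → i ≤ j := fun i j hij => hf.le_iff_le.1 (h (hg hij))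
  clear h hσ hmono
  revert h1
  revert σ
  decide

/-- The square of a matching with four edges such that both the first ends and the second ends are
in increasing order is, modulo binomial relations, a combination of squares of matchings of smaller
potential. -/
theorem sq_mem_of_strictMono (E : Graph L) (a b : Fin 4 → L)
    (h : IsRegular 1 (bipartiteGraph E a b 0 1 2 3))
    (ha : StrictMono (pos ∘ a)) (hb : StrictMono (pos ∘ b)) :
    matchingVal (bipartiteGraph E a b 0 1 2 3) ^ 2 ∈ binomialSpan L ⊔
      Submodule.span ℤ {x | ∃ Γ : Graph L, IsRegular 1 Γ ∧
        potential pos Γ < potential pos (bipartiteGraph E a b 0 1 2 3) ∧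
        x = matchingVal Γ ^ 2} := by
  classical
  set Q := binomialSpan L ⊔ Submodule.span ℤ {x | ∃ Γ : Graph L, IsRegular 1 Γ ∧
        potential pos Γ < potential pos (bipartiteGraph E a b 0 1 2 3) ∧
        x = matchingVal Γ ^ 2} with hQ
  obtain ⟨g, hg⟩ : ∃ g : Fin 4 → Fin 4 → Fin 4 → Fin 4 → SymmetricAlgebra ℤ (V L),
      ∀ c₀ c₁ c₂ c₃, g c₀ c₁ c₂ c₃ = matchingVal (bipartiteGraph E a b c₀ c₁ c₂ c₃) :=
    ⟨_, fun _ _ _ _ => rfl⟩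
  have hmem : ∀ c₀ c₁ c₂ c₃ : Fin 4, Function.Injective ![c₀, c₁, c₂, c₃] →
      ![c₀, c₁, c₂, c₃] ≠ id → g c₀ c₁ c₂ c₃ ^ 2 ∈ Q := by
    intro c₀ c₁ c₂ c₃ hinj hne
    obtain ⟨σ, hσ⟩ : ∃ σ : Equiv.Perm (Fin 4), ⇑σ = ![c₀, c₁, c₂, c₃] :=
      ⟨Equiv.ofBijective _ (Finite.injective_iff_bijective.1 hinj), rfl⟩
    have hσ' : g c₀ c₁ c₂ c₃ = g (σ 0) (σ 1) (σ 2) (σ 3) := by rw [hσ]; rfl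
    refine Submodule.mem_sup_right (Submodule.subset_span
      ⟨bipartiteGraph E a b (σ 0) (σ 1) (σ 2) (σ 3), fun v => ?_, ?_, by rw [hσ', hg]⟩)
    · have h1 := (valence_bipartiteGraph E a b id v).symm.trans (h v)
      have h2 := Equiv.sum_comp σ fun i => if v = b i then 1 else 0
      rw [valence_bipartiteGraph, h2]
      exact h1
    · have h1 := potential_bipartiteGraph pos E a b id
      have h2 := potential_bipartiteGraph pos E a b σ
      refine lt_of_eq_of_lt h2 (lt_of_lt_of_eq ?_ h1.symm)
      refine Nat.add_lt_add_right (sum_mul_perm_lt ha hb ?_) _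
      rintro rfl
      exact hne hσ.symm
  have hK : _ ∈ Q := Submodule.mem_sup_left ((binomialSpan L).smul_mem 2 (binomial_mem E a b h))
  -- The square for the identity permutation has coefficient one in the minor, and the other
  -- twenty-three squares have smaller potential.
  have key := isPluecker_matchingVal.sum_sq E a b g hg
  rw [← hg 0 1 2 3]
  have h1 := hmem 0 1 3 2 (by decide) (by decide)
  have h2 := hmem 0 2 1 3 (by decide) (by decide)
  have h3 := hmem 0 2 3 1 (by decide) (by decide)
  have h4 := hmem 0 3 1 2 (by decide) (by decide)
  have h5 := hmem 0 3 2 1 (by decide) (by decide)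
  have h6 := hmem 1 0 2 3 (by decide) (by decide)
  have h7 := hmem 1 0 3 2 (by decide) (by decide)
  have h8 := hmem 1 2 0 3 (by decide) (by decide)
  have h9 := hmem 1 2 3 0 (by decide) (by decide)
  have h10 := hmem 1 3 0 2 (by decide) (by decide)
  have h11 := hmem 1 3 2 0 (by decide) (by decide)
  have h12 := hmem 2 0 1 3 (by decide) (by decide)
  have h13 := hmem 2 0 3 1 (by decide) (by decide)
  have h14 := hmem 2 1 0 3 (by decide) (by decide)
  have h15 := hmem 2 1 3 0 (by decide) (by decide)
  have h16 := hmem 2 3 0 1 (by decide) (by decide)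
  have h17 := hmem 2 3 1 0 (by decide) (by decide)
  have h18 := hmem 3 0 1 2 (by decide) (by decide)
  have h19 := hmem 3 0 2 1 (by decide) (by decide)
  have h20 := hmem 3 1 0 2 (by decide) (by decide)
  have h21 := hmem 3 1 2 0 (by decide) (by decide)
  have h22 := hmem 3 2 0 1 (by decide) (by decide)
  have h23 := hmem 3 2 1 0 (by decide) (by decide)
  rw [two_smul] at hK
  -- `hsum` collects the twelve odd permutations, `hsum'` the eleven even ones other than the
  -- identity.
  have hsum := Q.add_mem (Q.add_mem (Q.add_mem (Q.add_mem (Q.add_mem (Q.add_mem h1 h2) h5) h6)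
    (Q.add_mem h9 h10)) (Q.add_mem (Q.add_mem h13 h14) (Q.add_mem h17 h18)))
    (Q.add_mem h21 h22)
  have hsum' := Q.add_mem (Q.add_mem (Q.add_mem (Q.add_mem (Q.add_mem (Q.add_mem h3 h4) h7) h8)
    (Q.add_mem h11 h12)) (Q.add_mem (Q.add_mem h15 h16) (Q.add_mem h19 h20))) h23
  convert Q.sub_mem (Q.add_mem hK hsum) hsum' using 1
  linear_combination key

/-- The matchings, with all edges directed upwards, for which no four edges are pairwise not
nested. -/
def standardMatchings (pos : L → ℕ) : Set (Graph L) :=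
  {Γ | IsRegular 1 Γ ∧ (∀ e ∈ Γ, pos e.1 < pos e.2) ∧ ¬ ∃ e : Fin 4 → L × L, (∀ i, e i ∈ Γ) ∧
    StrictMono (fun i => pos (e i).1) ∧ StrictMono (fun i => pos (e i).2)}

theorem IsRegular.fst_ne_snd {Γ : Graph L} (h : IsRegular 1 Γ) {e : L × L} (he : e ∈ Γ) :
    e.1 ≠ e.2 := by
  classical
  intro heq
  obtain ⟨E, rfl⟩ := Multiset.exists_cons_of_mem he
  have h1 := h e.1
  rw [valence_cons, if_pos rfl, if_pos heq] at h1
  omega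

/-- All edges of a graph can be directed upwards. -/
theorem exists_upward (Γ : Graph L) : ∃ Γ' : Graph L,
    (∀ E, matchingVal (Γ' + E) ^ 2 = matchingVal (Γ + E) ^ 2) ∧
    (∀ v, valence Γ' v = valence Γ v) ∧ potential pos Γ' = potential pos Γ ∧
    ∀ e ∈ Γ', pos e.1 ≤ pos e.2 := by
  induction Γ using Multiset.induction with
  | empty => exact ⟨0, by simp⟩
  | cons e Γ ih =>
    obtain ⟨a, b⟩ := e
    obtain ⟨Γ', h1, h2, h3, h4⟩ := ih
    have hsq : ∀ (E : Graph L), matchingVal ((a, b) ::ₘ Γ' + E) ^ 2 =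
        matchingVal ((a, b) ::ₘ Γ + E) ^ 2 := by
      intro E
      have := h1 ((a, b) ::ₘ E)
      rwa [Multiset.add_cons, Multiset.add_cons, ← Multiset.cons_add, ← Multiset.cons_add] at this
    have hval : ∀ v, valence ((a, b) ::ₘ Γ') v = valence ((a, b) ::ₘ Γ) v := by
      intro v
      simp only [valence_cons, h2]
    rcases le_total (pos a) (pos b) with hab | hab
    · exact ⟨(a, b) ::ₘ Γ', hsq, hval, by rw [potential_cons, potential_cons, h3],
        by simpa [hab] using h4⟩
    · refine ⟨(b, a) ::ₘ Γ', fun E => ?_, fun v => ?_, ?_, by simpa [hab] using h4⟩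
      · rw [← hsq E, Multiset.cons_add, isPluecker_matchingVal.sign, neg_sq, Multiset.cons_add]
      · rw [valence_cons_swap, hval]
      · rw [potential_cons, potential_cons, h3, mul_comm]

/-- Modulo binomial relations, the squares of the standard matchings span the squares of all
matchings. -/
theorem sq_mem_sup_standardMatchings (hpos : Function.Injective pos) :
    ∀ (n : ℕ) (Γ : Graph L), IsRegular 1 Γ → potential pos Γ = n →
      matchingVal Γ ^ 2 ∈ binomialSpan L ⊔
        Submodule.span ℤ ((fun Γ => matchingVal Γ ^ 2) '' standardMatchings pos) := by
  intro n
  induction n using Nat.strong_induction_on with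
  | _ n ih =>
    intro Γ₀ hΓ₀ hn
    obtain ⟨Γ, hsq, hval, hpot, hle⟩ := exists_upward (pos := pos) Γ₀
    have hΓ : IsRegular 1 Γ := fun v => (hval v).trans (hΓ₀ v)
    have hsq' := hsq 0
    rw [add_zero, add_zero] at hsq'
    rw [← hsq']
    have hlt : ∀ e ∈ Γ, pos e.1 < pos e.2 := fun e he =>
      lt_of_le_of_ne (hle e he) (hpos.ne (hΓ.fst_ne_snd he))
    by_cases hstd : Γ ∈ standardMatchings pos
    · exact Submodule.mem_sup_right (Submodule.subset_span ⟨Γ, hstd, rfl⟩)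
    obtain ⟨e, he, h1, h2⟩ : ∃ e : Fin 4 → L × L, (∀ i, e i ∈ Γ) ∧
        StrictMono (fun i => pos (e i).1) ∧ StrictMono (fun i => pos (e i).2) := by
      by_contra hcon
      exact hstd ⟨hΓ, hlt, hcon⟩
    have hinj : Function.Injective e := fun i j hij => h1.injective (by simp [hij])
    obtain ⟨E, hE⟩ : ∃ E, Γ = bipartiteGraph E (fun i => (e i).1) (fun i => (e i).2) 0 1 2 3 := by
      have hle : (Finset.univ.val.map e) ≤ Γ := by
        rw [Multiset.le_iff_subset (Finset.univ.nodup.map hinj)]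
        intro x hx
        obtain ⟨i, -, rfl⟩ := Multiset.mem_map.1 hx
        exact he i
      obtain ⟨E, rfl⟩ := Multiset.le_iff_exists_add.1 hle
      refine ⟨E, ?_⟩
      have : (Finset.univ : Finset (Fin 4)).val = 0 ::ₘ 1 ::ₘ 2 ::ₘ 3 ::ₘ 0 := rfl
      simp [bipartiteGraph, this]
    have hmem := sq_mem_of_strictMono (pos := pos) E (fun i => (e i).1) (fun i => (e i).2)
      (hE ▸ hΓ) h1 h2
    rw [← hE] at hmem
    refine SetLike.le_def.1 (sup_le le_sup_left (Submodule.span_le.2 ?_)) hmem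
    rintro _ ⟨Δ, hΔ, hlt, rfl⟩
    exact ih _ (by omega) Δ hΔ rfl

end Straightening

/-! ### The involution of a matching -/

section Partner

variable {L : Type u} {Γ : Graph L}

theorem ne_of_valence_eq_zero {v : L} (h : valence Γ v = 0) {e : L × L} (he : e ∈ Γ) :
    e.1 ≠ v ∧ e.2 ≠ v := by
  classical
  obtain ⟨E, rfl⟩ := Multiset.exists_cons_of_mem he
  rw [valence_cons] at h
  constructor
  · rintro rfl
    rw [if_pos rfl] at h
    omega
  · rintro rfl
    rw [if_pos rfl] at h
    omega

theorem IsRegular.eq_of_mem (hΓ : IsRegular 1 Γ) {v : L} {e f : L × L} (he : e ∈ Γ) (hf : f ∈ Γ)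
    (hev : e.1 = v ∨ e.2 = v) (hfv : f.1 = v ∨ f.2 = v) : e = f := by
  classical
  obtain ⟨E, rfl⟩ := Multiset.exists_cons_of_mem he
  have hE : valence E v = 0 := by
    have h := hΓ v
    rw [valence_cons] at h
    rcases hev with rfl | rfl
    · rw [if_pos rfl] at h
      omega
    · rw [if_pos rfl] at h
      omega
  rcases Multiset.mem_cons.1 hf with rfl | hf
  · rfl
  · have h := ne_of_valence_eq_zero hE hf
    exact (hfv.elim h.1 h.2).elim

theorem IsRegular.exists_mem (hΓ : IsRegular 1 Γ) (v : L) : ∃ e ∈ Γ, e.1 = v ∨ e.2 = v := by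
  classical
  by_contra! hcon
  have h := hΓ v
  rw [valence, Multiset.count_eq_zero_of_notMem, Multiset.count_eq_zero_of_notMem] at h
  · omega
  · intro hv
    obtain ⟨e, he, rfl⟩ := Multiset.mem_map.1 hv
    exact (hcon e he).2 rfl
  · intro hv
    obtain ⟨e, he, rfl⟩ := Multiset.mem_map.1 hv
    exact (hcon e he).1 rfl

/-- The involution which exchanges the ends of the edges of a matching. -/
theorem IsRegular.exists_partner (hΓ : IsRegular 1 Γ) : ∃ ι : Equiv.Perm L,
    (∀ v, ι (ι v) = v) ∧ (∀ e ∈ Γ, ι e.1 = e.2 ∧ ι e.2 = e.1) ∧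
      ∀ v, (v, ι v) ∈ Γ ∨ (ι v, v) ∈ Γ := by
  classical
  choose edge hmem hends using hΓ.exists_mem
  have hι : ∀ e ∈ Γ, (if (edge e.1).1 = e.1 then (edge e.1).2 else (edge e.1).1) = e.2 ∧
      (if (edge e.2).1 = e.2 then (edge e.2).2 else (edge e.2).1) = e.1 := by
    intro e he
    have h1 := hΓ.eq_of_mem he (hmem e.1) (Or.inl rfl) (hends e.1)
    have h2 := hΓ.eq_of_mem he (hmem e.2) (Or.inr rfl) (hends e.2)
    rw [← h1, ← h2, if_pos rfl, if_neg (hΓ.fst_ne_snd he)]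
    exact ⟨rfl, rfl⟩
  have hinv : Function.Involutive fun v => if (edge v).1 = v then (edge v).2 else (edge v).1 := by
    intro v
    obtain ⟨e, he, rfl | rfl⟩ := hΓ.exists_mem v
    · simp only [(hι e he).1, (hι e he).2]
    · simp only [(hι e he).1, (hι e he).2]
  obtain ⟨ι, hdef⟩ : ∃ ι : Equiv.Perm L,
      ∀ v, ι v = if (edge v).1 = v then (edge v).2 else (edge v).1 :=
    ⟨hinv.toPerm _, fun _ => rfl⟩
  simp only [← hdef] at hι
  refine ⟨ι, fun v => by simpa only [← hdef] using hinv v, hι, fun v => ?_⟩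
  obtain ⟨e, he, rfl | rfl⟩ := hΓ.exists_mem v
  · left
    rw [(hι e he).1]
    exact he
  · right
    rw [(hι e he).2]
    exact he

theorem IsRegular.univ_val_eq [Fintype L] (hΓ : IsRegular 1 Γ) :
    (Finset.univ : Finset L).val = Γ.map Prod.fst + Γ.map Prod.snd := by
  classical
  ext v
  rw [Multiset.count_univ, Multiset.count_add]
  have h := hΓ v
  rw [valence] at h
  convert h.symm

/-- Every edge is counted once from each end. -/
theorem IsRegular.sum_mul_partner [Fintype L] (hΓ : IsRegular 1 Γ) (pos : L → ℕ) {ι : L → L}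
    (hι : ∀ e ∈ Γ, ι e.1 = e.2 ∧ ι e.2 = e.1) :
    ∑ v, pos v * pos (ι v) = 2 * potential pos Γ := by
  rw [Finset.sum, hΓ.univ_val_eq, Multiset.map_add, Multiset.sum_add, Multiset.map_map,
    Multiset.map_map, potential, two_mul]
  congr 2
  · refine Multiset.map_congr rfl fun e he => ?_
    simp [(hι e he).1]
  · refine Multiset.map_congr rfl fun e he => ?_
    simp [(hι e he).2, mul_comm]

theorem IsRegular.nodup (hΓ : IsRegular 1 Γ) : Γ.Nodup := by
  classical
  rw [Multiset.nodup_iff_count_le_one]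
  intro e
  by_contra! h
  have h1 : e ∈ Γ := Multiset.count_pos.1 (by omega)
  obtain ⟨E, rfl⟩ := Multiset.exists_cons_of_mem h1
  have h2 : e ∈ E := Multiset.count_pos.1 (by rw [Multiset.count_cons_self] at h; omega)
  have h3 := hΓ e.1
  rw [valence_cons, if_pos rfl] at h3
  exact (ne_of_valence_eq_zero (v := e.1) (by omega) h2).1 rfl

theorem eq_of_partner {Γ Γ' : Graph L} (hΓ : IsRegular 1 Γ) (hΓ' : IsRegular 1 Γ') {pos : L → ℕ}
    (hlt : ∀ e ∈ Γ, pos e.1 < pos e.2) (hlt' : ∀ e ∈ Γ', pos e.1 < pos e.2) {ι : L → L}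
    (h : ∀ e ∈ Γ, ι e.1 = e.2) (h' : ∀ e ∈ Γ', ι e.1 = e.2)
    (hm : ∀ v, (v, ι v) ∈ Γ ∨ (ι v, v) ∈ Γ) (hm' : ∀ v, (v, ι v) ∈ Γ' ∨ (ι v, v) ∈ Γ') :
    Γ = Γ' := by
  refine (Multiset.Nodup.ext hΓ.nodup hΓ'.nodup).2 fun e => ⟨fun he => ?_, fun he => ?_⟩
  · rcases hm' e.1 with h1 | h1
    · rwa [h e he] at h1
    · rw [h e he] at h1
      exact absurd (hlt' _ h1) (not_lt.2 (hlt e he).le)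
  · rcases hm e.1 with h1 | h1
    · rwa [h' e he] at h1
    · rw [h' e he] at h1
      exact absurd (hlt _ h1) (not_lt.2 (hlt' e he).le)

end Partner

/-! ### Nested colour classes and rearrangement -/

section Coloring

variable {L : Type u} {pos : L → ℕ}

/-- The edges of a standard matching have a colouring by three colours such that edges of the same
colour are nested. -/
theorem exists_edge_coloring {Γ : Graph L} (hΓ : Γ ∈ standardMatchings pos) :
    ∃ col : L × L → Fin 3, ∀ e ∈ Γ, ∀ f ∈ Γ, pos e.1 < pos f.1 → pos e.2 < pos f.2 →
      col e ≠ col f := by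
  classical
  -- The colour is the height of the edge in the order comparing both ends; three values suffice
  -- because there is no chain of four edges.
  refine ⟨fun e => if ¬ ∃ f ∈ Γ, pos f.1 < pos e.1 ∧ pos f.2 < pos e.2 then 0
    else if ¬ ∃ f ∈ Γ, ∃ g ∈ Γ, (pos f.1 < pos g.1 ∧ pos f.2 < pos g.2) ∧
      (pos g.1 < pos e.1 ∧ pos g.2 < pos e.2) then 1 else 2, ?_⟩
  intro e he f hf h1 h2
  have hf0 : ∃ e ∈ Γ, pos e.1 < pos f.1 ∧ pos e.2 < pos f.2 := ⟨e, he, h1, h2⟩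
  simp only [hf0, not_true_eq_false, if_false]
  by_cases h0 : ∃ f ∈ Γ, pos f.1 < pos e.1 ∧ pos f.2 < pos e.2
  · obtain ⟨g, hg, hge⟩ := h0
    have hf1 : ∃ e ∈ Γ, ∃ g ∈ Γ, (pos e.1 < pos g.1 ∧ pos e.2 < pos g.2) ∧
      (pos g.1 < pos f.1 ∧ pos g.2 < pos f.2) := ⟨g, hg, e, he, hge, h1, h2⟩
    have he0 : ∃ f ∈ Γ, pos f.1 < pos e.1 ∧ pos f.2 < pos e.2 := ⟨g, hg, hge⟩
    simp only [hf1, he0, not_true_eq_false, if_false]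
    split_ifs with h3
    · obtain ⟨p, hp, q, hq, hpq, hqe⟩ := h3
      refine absurd ⟨![p, q, e, f], ?_, ?_, ?_⟩ hΓ.2.2
      · intro i
        fin_cases i <;> assumption
      · refine Fin.strictMono_iff_lt_succ.2 fun i => ?_
        fin_cases i
        exacts [hpq.1, hqe.1, h1]
      · refine Fin.strictMono_iff_lt_succ.2 fun i => ?_
        fin_cases i
        exacts [hpq.2, hqe.2, h2]
    · decide
  · rw [if_pos h0]
    split_ifs <;> decide

/-- The rearrangement inequality for matchings: a matching with pairwise nested edges of each colour
has the least potential among the matchings whose edges join vertices of the same colour. -/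
theorem eq_of_potential_le [Finite L] (hpos : Function.Injective pos) {Γ Γ' : Graph L}
    (hΓ : IsRegular 1 Γ) (hΓ' : IsRegular 1 Γ') (hlt : ∀ e ∈ Γ, pos e.1 < pos e.2)
    (hlt' : ∀ e ∈ Γ', pos e.1 < pos e.2) (w : L → ℕ) (hw : ∀ e ∈ Γ, w e.1 = w e.2)
    (hw' : ∀ e ∈ Γ', w e.1 = w e.2)
    (hnest : ∀ e ∈ Γ, ∀ f ∈ Γ, pos e.1 < pos f.1 → pos e.2 < pos f.2 → w e.1 ≠ w f.1)
    (hle : potential pos Γ' ≤ potential pos Γ) : Γ = Γ' := by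
  classical
  have := Fintype.ofFinite L
  obtain ⟨ι, hinv, hι, hm⟩ := hΓ.exists_partner
  obtain ⟨ι', hinv', hι', hm'⟩ := hΓ'.exists_partner
  have hwι : ∀ v, w (ι v) = w v := fun v => (hm v).elim (fun h => (hw _ h).symm) fun h => hw _ h
  have hwι' : ∀ v, w (ι' v) = w v :=
    fun v => (hm' v).elim (fun h => (hw' _ h).symm) fun h => hw' _ h
  -- Nesting means that the involution reverses the order within each colour, whichever ends of
  -- their edges `i` and `j` are.
  have hanti : ∀ i j, w i = w j → pos i < pos j → ¬ pos (ι i) < pos (ι j) := by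
    intro i j hij h1 h2
    have hi := hwι i
    have hj := hwι j
    rcases hm i with hi' | hi' <;> rcases hm j with hj' | hj'
    · exact hnest _ hi' _ hj' h1 h2 hij
    · have h3 := hlt _ hi'
      have h4 := hlt _ hj'
      simp only at h3 h4
      exact hnest _ hi' _ hj' (by simp only; omega) (by simp only; omega) (by simp only; omega)
    · have h3 := hlt _ hi'
      have h4 := hlt _ hj'
      simp only at h3 h4
      exact hnest _ hi' _ hj' (by simp only; omega) (by simp only; omega) (by simp only; omega)
    · exact hnest _ hi' _ hj' h2 h1 (by simp only; omega)
  obtain ⟨K, hK⟩ : ∃ K : ℕ, ∀ v, pos v < K :=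
    ⟨∑ v, pos v + 1, fun v => Nat.lt_succ_of_le
      (Finset.single_le_sum (fun _ _ => Nat.zero_le _) (Finset.mem_univ v))⟩
  -- The shifts by `K * w v`, with `K` above all positions, separate the colours, so that order
  -- reversal within each colour becomes order reversal on all of `L`.
  set f : L → ℤ := fun v => pos v + K * w v with hf
  set g : L → ℤ := fun v => pos (ι v) - K * w v with hg
  have hfg : Antivary f g := by
    intro i j hij
    simp only [hf, hg] at hij ⊢
    have hi := hK i
    have hj := hK j
    have hi' := hK (ι i)
    have hj' := hK (ι j)
    rcases lt_trichotomy (w i) (w j) with h | h | h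
    · have : (K : ℤ) * w j ≥ K * (w i + 1) := by
        refine mul_le_mul_of_nonneg_left ?_ (by positivity)
        exact_mod_cast h
      rw [mul_add, mul_one] at this
      omega
    · rw [h] at hij ⊢
      by_contra! hcon
      exact hanti i j h (by omega) (by omega)
    · have : (K : ℤ) * w i ≥ K * (w j + 1) := by
        refine mul_le_mul_of_nonneg_left ?_ (by positivity)
        exact_mod_cast h
      rw [mul_add, mul_one] at this
      omega
  set σ : Equiv.Perm L := ι * ι' with hσ
  have hισ : ∀ v, ι (σ v) = ι' v := fun v => hinv _
  have hwσ : ∀ v, w (σ v) = w v := fun v => (hwι _).trans (hwι' v)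
  -- For a colour-preserving involution the terms linear in `K` cancel in the sum, so comparing
  -- these sums amounts to comparing potentials.
  have hsum : ∀ (κ : Equiv.Perm L), (∀ v, w (κ v) = w v) → (∀ v, κ (κ v) = v) →
      ∑ v, f v * (pos (κ v) - K * w v : ℤ) =
        ∑ v, (pos v * pos (κ v) : ℤ) - ∑ v, (K * w v * (K * w v) : ℤ) := by
    intro κ h1 h2
    have h3 : ∑ v, (w v * pos (κ v) : ℤ) = ∑ v, (w v * pos v : ℤ) := by
      rw [← Equiv.sum_comp κ]
      exact Finset.sum_congr rfl fun v _ => by rw [h1, h2]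
    have h4 : ∑ v, (K * (w v * pos (κ v)) - K * (w v * pos v) : ℤ) = 0 := by
      rw [Finset.sum_sub_distrib, ← Finset.mul_sum, ← Finset.mul_sum, h3, sub_self]
    rw [← add_zero (∑ v, (pos v * pos (κ v) : ℤ) - _), ← h4, ← Finset.sum_sub_distrib,
      ← Finset.sum_add_distrib]
    exact Finset.sum_congr rfl fun v _ => by simp only [hf]; ring
  -- Otherwise the strict rearrangement inequality would give `Γ'` a larger potential than `Γ`.
  have hanti' : Antivary f (g ∘ σ) := by
    by_contra hcon
    have h1 := hfg.sum_mul_lt_sum_mul_comp_perm_iff.2 hcon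
    have h2 : ∑ v, f v * g (σ v) = ∑ v, f v * (pos (ι' v) - K * w v : ℤ) :=
      Finset.sum_congr rfl fun v _ => by simp only [hg, hισ, hwσ]
    simp only [smul_eq_mul] at h1
    rw [h2, hsum ι' hwι' hinv', hsum ι hwι hinv] at h1
    have h3 := hΓ.sum_mul_partner pos hι
    have h4 := hΓ'.sum_mul_partner pos hι'
    zify at h3 h4
    rw [h3, h4] at h1
    omega
  -- Both `ι` and `ι'` reverse the order within each colour, so `σ` preserves it; a permutation that
  -- also preserves the colours is then the identity.
  have hmono : ∀ i j, w i = w j → pos (σ i) < pos (σ j) → pos i < pos j := by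
    intro i j hij h
    have h1 := hanti (σ i) (σ j) (by rw [hwσ, hwσ, hij]) h
    rw [hισ, hισ] at h1
    have hne : i ≠ j := by rintro rfl; omega
    have h2 : pos (ι' i) ≠ pos (ι' j) := fun h => hne (ι'.injective (hpos h))
    have h3 : f i ≤ f j := hanti' (by
      simp only [Function.comp, hg, hισ, hwσ, hij]
      omega)
    simp only [hf, hij] at h3
    have h4 := hpos.ne hne
    omega
  have hfix : ∀ n i, pos i = n → σ i = i := by
    intro n
    induction n using Nat.strong_induction_on with
    | _ n ih =>
      intro i hi
      rcases lt_trichotomy (pos (σ i)) (pos i) with h | h | h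
      · exact σ.injective (ih _ (hi ▸ h) (σ i) rfl)
      · exact hpos h
      · obtain ⟨j, hj⟩ := σ.surjective i
        have h1 : pos j < pos i := hmono j i (by rw [← hwσ j, hj]) (by rwa [hj])
        have h2 := ih _ (hi ▸ h1) j rfl
        rw [hj] at h2
        rw [h2, hj, h2]
  have heq : ∀ v, ι' v = ι v := fun v => by rw [← hισ v, hfix _ v rfl]
  exact eq_of_partner hΓ hΓ' hlt hlt' (ι := ι) (fun e he => (hι e he).1)
    (fun e he => (heq _).symm.trans (hι' e he).1) hm fun v => by rw [← heq v]; exact hm' v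

end Coloring

/-! ### The conic and multilinear extension -/

section Conic

/-- A quadratic form on a space of dimension three with the rational points of a conic
isotropic, as a bilinear form. -/
def conicForm (x y : Fin 3 → ℚ) : ℚ := (x 0 * y 0 - x 1 * y 1 - x 2 * y 2) / 2

/-- The point of the conic with the parameters `u`, `v`. -/
def conicPoint (u v : ℚ) : Fin 3 → ℚ := ![u ^ 2 + v ^ 2, u ^ 2 - v ^ 2, 2 * u * v]

theorem conicForm_conicPoint (u v u' v' : ℚ) :
    conicForm (conicPoint u v) (conicPoint u' v') = (u * v' - u' * v) ^ 2 := by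
  simp [conicForm, conicPoint]
  ring

theorem conicForm_comm (x y : Fin 3 → ℚ) : conicForm x y = conicForm y x := by
  simp only [conicForm]
  ring

theorem conicForm_single (i j : Fin 3) :
    conicForm (Pi.single i 1) (Pi.single j 1) ≠ 0 ↔ i = j := by
  fin_cases i <;> fin_cases j <;> simp [conicForm]

/-- The form in the first variable, as a linear map. -/
def conicFormLeft (z : Fin 3 → ℚ) : (Fin 3 → ℚ) →ₗ[ℚ] ℚ where
  toFun y := conicForm y z
  map_add' x y := by simp only [conicForm, Pi.add_apply]; ring
  map_smul' c x := by
    simp only [conicForm, Pi.smul_apply, smul_eq_mul, RingHom.id_apply]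
    ring

variable {L : Type u}

/-- A function of vectors which is linear in each of them vanishes if it vanishes at points of
the conic. -/
theorem eq_zero_of_conic [Finite L] [DecidableEq L] {F : (L → Fin 3 → ℚ) → ℚ}
    (hF : ∀ x v, ∃ l : (Fin 3 → ℚ) →ₗ[ℚ] ℚ, ∀ y, F (Function.update x v y) = l y)
    (hzero : ∀ u v : L → ℚ, F (fun i => conicPoint (u i) (v i)) = 0) (x : L → Fin 3 → ℚ) :
    F x = 0 := by
  let m : MultilinearMap ℚ (fun _ : L => Fin 3 → ℚ) ℚ := MultilinearMap.mk' F
    (fun x v y z => by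
      obtain ⟨l, hl⟩ := hF x v
      rw [hl, hl, hl, map_add])
    (fun x v c y => by
      obtain ⟨l, hl⟩ := hF x v
      rw [hl, hl, map_smul])
  -- Three points of the conic that form a basis of the space, which is enough to detect a
  -- multilinear function.
  let p : Fin 3 → ℚ × ℚ := ![(1, 0), (0, 1), (1, 1)]
  have hli : LinearIndependent ℚ fun i => conicPoint (p i).1 (p i).2 := by
    refine Matrix.linearIndependent_rows_of_det_ne_zero
      (A := Matrix.of fun i => conicPoint (p i).1 (p i).2) ?_
    simp only [Matrix.det_fin_three, Matrix.of_apply, p, conicPoint, Matrix.cons_val]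
    norm_num
  let b := basisOfLinearIndependentOfCardEqFinrank hli (by simp)
  have hm : m = 0 := by
    refine Module.Basis.ext_multilinear (fun _ => b) fun w => ?_
    simp only [b, coe_basisOfLinearIndependentOfCardEqFinrank]
    exact hzero (fun i => (p (w i)).1) fun i => (p (w i)).2
  exact congrArg (fun m => m x) hm

/-- The product of the values of the form on the edges of a graph. -/
def formVal (x : L → Fin 3 → ℚ) (Γ : Graph L) : ℚ :=
  (Γ.map fun e => conicForm (x e.1) (x e.2)).prod

theorem formVal_conicPoint (u v : L → ℚ) (Γ : Graph L) :
    formVal (fun i => conicPoint (u i) (v i)) Γ = graphEval u v Γ ^ 2 := by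
  simp only [formVal, graphEval, conicForm_conicPoint, Multiset.prod_map_pow]

/-- In a matching each vertex lies on exactly one edge, so exactly one factor involves `x v`. -/
theorem formVal_update [DecidableEq L] {Γ : Graph L} (hΓ : IsRegular 1 Γ) (x : L → Fin 3 → ℚ)
    (v : L) : ∃ l : (Fin 3 → ℚ) →ₗ[ℚ] ℚ, ∀ y, formVal (Function.update x v y) Γ = l y := by
  obtain ⟨e, he, hev⟩ := hΓ.exists_mem v
  have hne := hΓ.fst_ne_snd he
  obtain ⟨E, rfl⟩ := Multiset.exists_cons_of_mem he
  have hE : ∀ y, formVal (Function.update x v y) E = formVal x E := by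
    intro y
    refine congrArg Multiset.prod (Multiset.map_congr rfl fun f hf => ?_)
    have hv : valence E v = 0 := by
      have h := hΓ v
      rw [valence_cons] at h
      rcases hev with rfl | rfl
      · rw [if_pos rfl] at h
        omega
      · rw [if_pos rfl] at h
        omega
    obtain ⟨h1, h2⟩ := ne_of_valence_eq_zero hv hf
    rw [Function.update_of_ne h1, Function.update_of_ne h2]
  have hcons : ∀ x : L → Fin 3 → ℚ, formVal x (e ::ₘ E) =
      conicForm (x e.1) (x e.2) * formVal x E := fun x => by simp [formVal]
  rcases hev with rfl | rfl
  · refine ⟨formVal x E • conicFormLeft (x e.2), fun y => ?_⟩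
    rw [hcons, hE, Function.update_self, Function.update_of_ne hne.symm, mul_comm]
    rfl
  · refine ⟨formVal x E • conicFormLeft (x e.1), fun y => ?_⟩
    rw [hcons, hE, Function.update_self, Function.update_of_ne hne, mul_comm, conicForm_comm]
    rfl

end Conic

/-! ### Independence of standard squares and the conclusion -/

section Independence

variable {L : Type u} [Finite L] {pos : L → ℕ}

/-- The squares of the standard matchings are linearly independent in `R_L`. -/
theorem standardMatchings_independent (hpos : Function.Injective pos) (c : Graph L →₀ ℤ)
    (hc : ∀ Γ ∈ c.support, Γ ∈ standardMatchings pos)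
    (hzero : ∀ u v : L → ℚ, ∑ Γ ∈ c.support, (c Γ : ℚ) * graphEval u v Γ ^ 2 = 0) : c = 0 := by
  classical
  have hform : ∀ x : L → Fin 3 → ℚ, ∑ Γ ∈ c.support, (c Γ : ℚ) * formVal x Γ = 0 := by
    refine eq_zero_of_conic (fun x v => ?_) fun u v => ?_
    · have h : ∀ Γ : Graph L, ∃ l : (Fin 3 → ℚ) →ₗ[ℚ] ℚ, Γ ∈ c.support →
          ∀ y, formVal (Function.update x v y) Γ = l y := by
        intro Γ
        by_cases hΓ : Γ ∈ c.support
        · obtain ⟨l, hl⟩ := formVal_update (hc Γ hΓ).1 x v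
          exact ⟨l, fun _ => hl⟩
        · exact ⟨0, fun h => absurd h hΓ⟩
      choose l hl using h
      refine ⟨∑ Γ ∈ c.support, (c Γ : ℚ) • l Γ, fun y => ?_⟩
      rw [LinearMap.sum_apply]
      exact Finset.sum_congr rfl fun Γ hΓ => by rw [hl Γ hΓ, LinearMap.smul_apply, smul_eq_mul]
    · rw [← hzero u v]
      exact Finset.sum_congr rfl fun Γ _ => by rw [formVal_conicPoint]
  by_contra hne
  -- At the vectors given by a colouring of `Γ`, a matching has nonzero value only if its edges join
  -- vertices of equal colour. By `eq_of_potential_le` the only such matching with potential at most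
  -- that of `Γ` is `Γ` itself, so maximality isolates the coefficient of `Γ`.
  obtain ⟨Γ, hΓ, hmax⟩ := c.support.exists_max_image (potential pos)
    (Finsupp.support_nonempty_iff.2 hne)
  have hstd := hc Γ hΓ
  obtain ⟨col, hcol⟩ := exists_edge_coloring hstd
  choose edge hmem hends using hstd.1.exists_mem
  have hedge : ∀ e ∈ Γ, edge e.1 = e ∧ edge e.2 = e := fun e he =>
    ⟨hstd.1.eq_of_mem (hmem _) he (hends _) (Or.inl rfl),
      hstd.1.eq_of_mem (hmem _) he (hends _) (Or.inr rfl)⟩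
  have hval : ∀ Δ : Graph L, formVal (fun v => Pi.single (col (edge v)) 1) Δ ≠ 0 ↔
      ∀ e ∈ Δ, col (edge e.1) = col (edge e.2) := by
    intro Δ
    rw [formVal, Ne, Multiset.prod_eq_zero_iff]
    simp only [Multiset.mem_map, not_exists, not_and]
    exact forall₂_congr fun e _ => conicForm_single _ _
  have hother : ∀ Δ ∈ c.support, Δ ≠ Γ →
      (c Δ : ℚ) * formVal (fun v => Pi.single (col (edge v)) 1) Δ = 0 := by
    intro Δ hΔ hne
    by_contra h
    have hΔ' := hc Δ hΔ
    have h1 := (hval Δ).1 (right_ne_zero_of_mul h)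
    refine hne (eq_of_potential_le hpos hstd.1 hΔ'.1 hstd.2.1 hΔ'.2.1
      (fun v => (col (edge v) : ℕ)) (fun e he => ?_) (fun e he => ?_) (fun e he f hf h2 h3 => ?_)
      (hmax Δ hΔ)).symm
    · simp only [(hedge e he).1, (hedge e he).2]
    · simp only [h1 e he]
    · simp only [(hedge e he).1, (hedge f hf).1]
      exact fun h => hcol e he f hf h2 h3 (Fin.ext h)
  have h := hform fun v => Pi.single (col (edge v)) 1
  rw [Finset.sum_eq_single_of_mem Γ hΓ hother] at h
  refine mul_ne_zero ?_ ?_ h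
  · exact_mod_cast Finsupp.mem_support_iff.1 hΓ
  · exact (hval Γ).2 fun e he => by rw [(hedge e he).1, (hedge e he).2]

/-- Every quadratic relation has a multiple by a power of two which is an integral combination of
simple binomial relations. -/
theorem quadraticRelations_le_binomialSpan : quadraticRelations L ≤ binomialSpan L := by
  intro r hr
  obtain ⟨pos, hpos⟩ : ∃ pos : L → ℕ, Function.Injective pos := exists_injective_nat L
  have hsq : ∀ Γ : Graph L, matchingVal Γ ^ 2 ∈ twoSaturation (binomialSpan L ⊔
      Submodule.span ℤ ((fun Γ => matchingVal Γ ^ 2) '' standardMatchings pos)) := by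
    intro Γ
    by_cases hΓ : IsRegular 1 Γ
    · exact le_twoSaturation _ (sq_mem_sup_standardMatchings hpos _ Γ hΓ rfl)
    · rw [matchingVal, dif_neg hΓ, zero_pow two_ne_zero]
      exact Submodule.zero_mem _
  obtain ⟨k, hk⟩ := symPiece_two_le (fun x => mem_twoSaturation_of_two_smul) hsq hr.2
  -- The power of two in the saturation can be cancelled because the values lie in `ℚ`.
  have hrel : ∀ x ∈ binomialSpan L, ∀ u v : L → ℚ, ringEval u v (symToRing L x) = 0 := by
    rintro x ⟨j, hj⟩ u v
    have h : Submodule.span ℤ {x | IsSimpleBinomial x} ≤ quadraticRelations L :=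
      Submodule.span_le.2 fun x hx => IsSimpleBinomial.mem hx
    have h1 : symToRing L ((2 ^ j : ℤ) • x) = 0 := (h hj).1
    have h2 := congrArg (ringEval u v) h1
    rw [map_zsmul, map_zsmul, map_zero, smul_eq_zero] at h2
    exact h2.resolve_left (by positivity)
  obtain ⟨x, hx, y, hy, hxy⟩ := Submodule.mem_sup.1 hk
  obtain ⟨c, hc, rfl⟩ := (Finsupp.mem_span_image_iff_linearCombination ℤ).1 hy
  -- The relation and the binomial part both evaluate to zero, hence so does the combination of
  -- standard squares.
  have hc0 : c = 0 := by
    refine standardMatchings_independent hpos c (fun Γ hΓ => hc hΓ) fun u v => ?_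
    have h1 : symToRing L ((2 ^ k : ℤ) • r) = 0 := by
      rw [map_zsmul, show symToRing L r = 0 from hr.1, smul_zero]
    have h2 := congrArg (ringEval u v) h1
    rw [← hxy, map_add, map_add, hrel x hx, zero_add, map_zero,
      Finsupp.linearCombination_apply, Finsupp.sum, map_sum, map_sum] at h2
    rw [← h2]
    refine Finset.sum_congr rfl fun Γ hΓ => ?_
    rw [map_zsmul, map_zsmul, map_pow, map_pow, ringEval_symToRing_matchingVal u v (hc hΓ).1,
      zsmul_eq_mul]
  rw [hc0, map_zero, add_zero] at hxy
  obtain ⟨j, hj⟩ := hx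
  exact ⟨j + k, by rwa [pow_add, mul_smul, ← hxy]⟩

/-- If every element of `Q` has a multiple by a power of two in the span of `S`, then `S` spans
over each ring in which two is invertible. -/
theorem span_tmul_eq_top {Q : Type*} [AddCommGroup Q] {S : Set Q}
    (hS : ∀ r : Q, ∃ k : ℕ, (2 ^ k : ℤ) • r ∈ Submodule.span ℤ S) {A : Type*} [CommRing A]
    (h2 : IsUnit (2 : A)) :
    Submodule.span A ((fun r : Q => (1 : A) ⊗ₜ[ℤ] r) '' S) = ⊤ := by
  have hspan : ∀ x ∈ Submodule.span ℤ S, (1 : A) ⊗ₜ[ℤ] x ∈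
      Submodule.span A ((fun r : Q => (1 : A) ⊗ₜ[ℤ] r) '' S) := by
    intro x hx
    induction hx using Submodule.span_induction with
    | mem x hx => exact Submodule.subset_span ⟨x, hx, rfl⟩
    | zero =>
      rw [TensorProduct.tmul_zero]
      exact Submodule.zero_mem _
    | add x y _ _ hx hy =>
      rw [TensorProduct.tmul_add]
      exact Submodule.add_mem _ hx hy
    | smul n x _ hx =>
      rw [TensorProduct.tmul_smul]
      exact zsmul_mem hx n
  have hone : ∀ r : Q, (1 : A) ⊗ₜ[ℤ] r ∈
      Submodule.span A ((fun r : Q => (1 : A) ⊗ₜ[ℤ] r) '' S) := by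
    intro r
    obtain ⟨k, hk⟩ := hS r
    have h := hspan _ hk
    rw [TensorProduct.tmul_smul, ← Int.cast_smul_eq_zsmul A, Int.cast_pow, Int.cast_ofNat] at h
    exact (Submodule.smul_mem_iff_of_isUnit _ (h2.pow k)).1 h
  rw [eq_top_iff]
  intro t _
  induction t using TensorProduct.induction_on with
  | zero => exact Submodule.zero_mem _
  | tmul a r =>
    have := Submodule.smul_mem _ a (hone r)
    rwa [TensorProduct.smul_tmul', smul_eq_mul, mul_one] at this
  | add x y hx hy => exact Submodule.add_mem _ (hx trivial) (hy trivial)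

/-- The quadratic relations are spanned by simple binomial relations over each ring in which two is
invertible. -/
theorem spannedBySimpleBinomials_of_isUnit_two (A : Type) [CommRing A] (h2 : IsUnit (2 : A)) :
    SpannedBySimpleBinomials A L := by
  refine span_tmul_eq_top (fun r => ?_) h2
  obtain ⟨k, hk⟩ := quadraticRelations_le_binomialSpan r.2
  refine ⟨k, ?_⟩
  have himage : (quadraticRelations L).subtype '' simpleBinomials L = {x | IsSimpleBinomial x} := by
    ext x
    constructor
    · rintro ⟨y, hy, rfl⟩
      exact hy
    · intro hx
      exact ⟨⟨x, hx.mem⟩, hx, rfl⟩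
  rw [← himage, ← Submodule.map_span] at hk
  obtain ⟨y, hy, hyr⟩ := hk
  have hy' : y = (2 ^ k : ℤ) • r := Subtype.ext hyr
  rwa [hy'] at hy

end Independence

end PointsOnLine

end

/-- The relations are spanned by simple binomial relations over every ring in which two is
invertible, whatever the number of points; the hypotheses on smaller sets are not needed. -/
theorem theorem1p3 (N : ℕ) (hN : 0 < N) (L : Type u) [Finite L]
    (hEven : Even (Nat.card L)) (h10 : 10 ≤ Nat.card L) (h12 : Nat.card L ≠ 12)
    (hsmaller : ∀ (L' : Type u) [Finite L'], Even (Nat.card L') → Nat.card L' < Nat.card L →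
      PointsOnLine.SpannedBySimpleBinomials (Localization.Away (2 * N : ℤ)) L') :
    PointsOnLine.SpannedBySimpleBinomials (Localization.Away (2 * N : ℤ)) L := by
  refine PointsOnLine.spannedBySimpleBinomials_of_isUnit_two _ ?_
  have h := IsLocalization.Away.algebraMap_isUnit (S := Localization.Away (2 * N : ℤ)) (2 * N : ℤ)
  rw [map_mul, map_ofNat] at h
  exact isUnit_of_mul_isUnit_left h
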